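/- Let $\alpha,\beta,d\in\mathbb R$ with $\alpha\neq0$, $\beta\neq0$, and put $e=-\frac{\beta(d+1)+\alpha}{\alpha}$. On $\{q_1,q_2>0\}\times\mathbb R^2$, with coordinates $(q_1,q_2,p_1,p_2)$ and canonical Poisson bivector $P$, consider $$H_1=2p_1p_2+V,\qquad V=q_1^{e}\,q_2^{d},\qquad \rho=\alpha p_1q_1+\beta p_2q_2 ,$$ the Hamiltonian vector field $X=P\,dH_1=[2p_2,\,2p_1,\,-\partial V/\partial q_1,\,-\partial V/\partial q_2]^T$ and the bivector $P'=\mathcal L_{\rho X}P$, that is, the antisymmetric matrix with entries (writing $V_i=\partial V/\partial q_i$) $$P'_{12}=-2\alpha p_1q_1+2\beta p_2q_2,\quad P'_{13}=-2\alpha p_1p_2+\alpha q_1V_1,\quad P'_{14}=-2\beta p_2^2+\alpha q_1V_2,$$ $$P'_{23}=-2\alpha p_1^2+\beta q_2V_1,\quad P'_{24}=-2\beta p_1p_2+\beta q_2V_2,\quad P'_{34}=-\alpha p_1V_2+\beta p_2V_1 .$$ The bi-Hamiltonian equations with parameter $\kappa_2\in\mathbb R$ for a smooth function $H_2$ are $$\kappa_2H_2\,X=P'\,dH_2.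 \qquad (*)$$ "Quadratic in the momenta" means polynomial in $p_1,p_2$ of total degree at most $2$ with smooth coefficients in $(q_1,q_2)$. An "additional" function is one whose differential is linearly independent of $dH_1$ at some point. The four families are | | relation | $H_1$ | $I_2$ | $H_2$ | |---|---|---|---|---| | 1 | $\alpha=-\beta$ | $2p_1p_2+q_1^dq_2^d$ | $q_1p_1-q_2p_2$ | $0$ | | 2 | $\alpha=-2\beta(d+1)$ | $2p_1p_2+\dfrac{q_2^d}{\sqrt{q_1}}$ | $2p_1(q_2p_2-p_1q_1)+\dfrac{q_2^{d+1}}{\sqrt{q_1}}$ | $I_2^{-1/\alpha}$ | | 3 | $\alpha=-\dfrac{\beta(d+1)}2$ | $2p_1p_2+q_1q_2^d$ | $p_1^2+\dfrac{q_2^{d+1}}{d+1}$ | $I_2^{-1/(2\alpha)}$ | | 4 | $\alpha=\beta$ | $2p_1p_2+\dfrac{q_2^d}{q_1^{d+2}}$ | $(p_1q_1-p_2q_2)^2-\dfrac{2q_2^{d+1}}{q_1^{d+1}}$ | $I_2H_1^{-1/(2\alpha)}$ | **(a) There are only four families.** Suppose that $V$ depends on both variables, i.e. $d\neq0$ and $e\neq0$,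 and let $D$ be any nonempty open subset of $\{q_1,q_2>0\}$. The following are equivalent: 1. Up to the permutation of the pairs $(q_1,p_1)$ and $(q_2,p_2)$ (which exchanges $\alpha$ with $\beta$ and $d$ with $e$), $V$ is the potential of one of the four families and, if $d\ne-1$, the parameters satisfy the relation of that family. (For $d=-1$ one has $V=1/(q_1q_2)$, the common potential of families 1 and 4, whatever $\alpha$ and $\beta$ are.) 2. There are an additional first integral $I_2$ of $H_1$ over $D$, quadratic in the momenta, and a solution $H_2$ of $(*)$ with $\kappa_2=1$ on some nonempty open subset of $D\times\mathbb R^2$, such that $H_2$ depends functionally on $H_1$ and $I_2$, i.e. $dH_2\in\operatorname{span}(dH_1,dI_2)$ at every point of that subset (the solution $H_2=0$ is allowed, as in family 1). 3. $H_1$ has an additional first integral over $D$ which is quadratic in the momenta. 4. For some $\kappa_2\in\mathbb R$, the equations $(*)$ have on $D\times\mathbb R^2$ an additional solution $H_2$ which is itself quadratic in the momenta. **(b) All four occur.** If $\alpha,\beta,d$ satisfy the relation of a family, then $H_1$ is the Hamiltonian listed there; the listed $I_2$ is a first integral, quadratic in the momenta, with $dH_1,dI_2$ linearly independent on a dense subset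 of $\{q_1,q_2>0\}\times\mathbb R^2$; and the listed $H_2$ solves $(*)$ with $\kappa_2=1$ on the open set where the base of the real power in it is positive (on all of $\{q_1,q_2>0\}\times\mathbb R^2$ in family 1), which is nonempty. **(c)** If $\alpha=-\beta$ and $I_2=q_1p_1-q_2p_2$, then any solution $H_2$ of $(*)$ with $\kappa_2=1$ on an open subset of $\{q_1,q_2>0\}\times\mathbb R^2$ with $dH_2\in\operatorname{span}(dH_1,dI_2)$ everywhere vanishes identically. -/

import Mathlib

open scoped ContDiff

namespace BiHam

/-- Phase space `ℝ⁴` with coordinates `x = (q₁, q₂, p₁, p₂)`. -/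
abbrev Phase : Type := Fin 4 → ℝ

/-- The open positive quadrant of the configuration plane, where all real powers are defined. -/
def quadrant : Set (ℝ × ℝ) := {q | 0 < q.1 ∧ 0 < q.2}

/-- The part `D × ℝ²` of phase space lying over a set `D` of configurations. -/
def phaseOver (D : Set (ℝ × ℝ)) : Set Phase := {x | (x 0, x 1) ∈ D}

/-- Partial derivative `∂F/∂xᵢ`. -/
noncomputable def partialD (F : Phase → ℝ) (i : Fin 4) (x : Phase) : ℝ :=
  fderiv ℝ F x (Pi.single i 1)

/-- The gradient `[∂F/∂q₁, ∂F/∂q₂, ∂F/∂p₁, ∂F/∂p₂]`. -/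
noncomputable def grad (F : Phase → ℝ) (x : Phase) : Phase := fun i => partialD F i x

/-- The canonical Poisson bracket. -/
noncomputable def bracket (F G : Phase → ℝ) (x : Phase) : ℝ :=
  partialD F 0 x * partialD G 2 x - partialD F 2 x * partialD G 0 x
    + (partialD F 1 x * partialD G 3 x - partialD F 3 x * partialD G 1 x)

/-- `∂V/∂q₁`. -/
noncomputable def dV₁ (V : ℝ → ℝ → ℝ) (q₁ q₂ : ℝ) : ℝ := deriv (fun t => V t q₂) q₁

/-- `∂V/∂q₂`. -/
noncomputable def dV₂ (V : ℝ → ℝ → ℝ) (q₁ q₂ : ℝ) : ℝ := deriv (fun t => V q₁ t) q₂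

/-- The natural Hamiltonian `H₁ = 2 p₁ p₂ + V(q₁, q₂)`. -/
def ham (V : ℝ → ℝ → ℝ) (x : Phase) : ℝ := 2 * x 2 * x 3 + V (x 0) (x 1)

/-- The Hamiltonian vector field `X = P dH₁` of `H₁` for the canonical bivector `P`. -/
noncomputable def hamField (V : ℝ → ℝ → ℝ) (x : Phase) : Phase :=
  ![2 * x 3, 2 * x 2, -dV₁ V (x 0) (x 1), -dV₂ V (x 0) (x 1)]

/-- The second bivector `P' = L_Y P`, where `Y = ρ X` and `ρ = α p₁ q₁ + β p₂ q₂`, written out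
in the coordinates `(q₁, q₂, p₁, p₂)`. -/
noncomputable def secondBivector (α β : ℝ) (V : ℝ → ℝ → ℝ) (x : Phase) :
    Matrix (Fin 4) (Fin 4) ℝ :=
  let q₁ := x 0
  let q₂ := x 1
  let p₁ := x 2
  let p₂ := x 3
  let V₁ := dV₁ V q₁ q₂
  let V₂ := dV₂ V q₁ q₂
  let b12 := -2 * α * p₁ * q₁ + 2 * β * p₂ * q₂
  let b13 := -2 * α * p₁ * p₂ + α * q₁ * V₁
  let b14 := -2 * β * p₂ ^ 2 + α * q₁ * V₂
  let b23 := -2 * α * p₁ ^ 2 + β * q₂ * V₁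
  let b24 := -2 * β * p₁ * p₂ + β * q₂ * V₂
  let b34 := -α * p₁ * V₂ + β * p₂ * V₁
  !![0, b12, b13, b14;
     -b12, 0, b23, b24;
     -b13, -b23, 0, b34;
     -b14, -b24, -b34, 0]

/-- `H₂` is smooth on the set `W` and satisfies there the bi-Hamiltonian equations
`κ H₂ X = P' dH₂`. -/
def SolvesBiHam (α β κ : ℝ) (V : ℝ → ℝ → ℝ) (H₂ : Phase → ℝ) (W : Set Phase) : Prop :=
  ContDiffOn ℝ ∞ H₂ W ∧
    ∀ x ∈ W, (κ * H₂ x) • hamField V x = (secondBivector α β V x).mulVec (grad H₂ x)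

/-- Over `D`, the function `F` is a polynomial in the momenta `p₁, p₂` of total degree at most `M`
whose coefficients are smooth functions of `(q₁, q₂) ∈ D`. -/
def PolyInMomenta (M : ℕ) (D : Set (ℝ × ℝ)) (F : Phase → ℝ) : Prop :=
  ∃ g : ℕ → ℕ → ℝ × ℝ → ℝ,
    (∀ k m, ContDiffOn ℝ ∞ (g k m) D) ∧
    ∀ x ∈ phaseOver D, F x = ∑ k ∈ Finset.range (M + 1), ∑ m ∈ Finset.range (M + 1 - k),
      g k m (x 0, x 1) * x 2 ^ m * x 3 ^ k

/-- Over `D`, the function `I₂` is a first integral of the Hamiltonian system generated by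
`H₁ = 2 p₁ p₂ + V`, polynomial of degree at most two in the momenta. -/
def IsQuadraticIntegral (V : ℝ → ℝ → ℝ) (D : Set (ℝ × ℝ)) (I₂ : Phase → ℝ) : Prop :=
  PolyInMomenta 2 D I₂ ∧ ∀ x ∈ phaseOver D, bracket (ham V) I₂ x = 0

/-- The differentials of `F` and `G` are linearly independent at `x`. -/
def IndepAt (F G : Phase → ℝ) (x : Phase) : Prop :=
  LinearIndependent ℝ ![fderiv ℝ F x, fderiv ℝ G x]

/-- `H₂` depends functionally on `F` and `G` on `W`: its differential is everywhere a linear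
combination of those of `F` and `G`. -/
def DependsOn (H₂ F G : Phase → ℝ) (W : Set Phase) : Prop :=
  ∀ x ∈ W, fderiv ℝ H₂ x ∈ Submodule.span ℝ {fderiv ℝ F x, fderiv ℝ G x}

/-- The exponent `-(β (d + 1) + α) / α` of `q₁`. -/
noncomputable def expo (α β d : ℝ) : ℝ := -(β * (d + 1) + α) / α

/-- The monomial potential `q₁ ^ (-(β (d + 1) + α) / α) * q₂ ^ d`. -/
noncomputable def monoV (α β d : ℝ) (q₁ q₂ : ℝ) : ℝ := q₁ ^ expo α β d * q₂ ^ d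

/-! ### The four families (rows `0, 1, 2, 3`) -/

/-- The relation between the parameters. -/
def rowRel (k : Fin 4) (α β d : ℝ) : Prop :=
  match k with
  | 0 => α = -β
  | 1 => α = -2 * β * (d + 1)
  | 2 => α = -(β * (d + 1) / 2)
  | 3 => α = β

/-- The potential. -/
noncomputable def rowV (k : Fin 4) (d q₁ q₂ : ℝ) : ℝ :=
  match k with
  | 0 => q₁ ^ d * q₂ ^ d
  | 1 => q₂ ^ d / Real.sqrt q₁
  | 2 => q₁ * q₂ ^ d
  | 3 => q₂ ^ d / q₁ ^ (d + 2)

/-- The integral `I₂`. -/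
noncomputable def rowI (k : Fin 4) (d : ℝ) (x : Phase) : ℝ :=
  let q₁ := x 0
  let q₂ := x 1
  let p₁ := x 2
  let p₂ := x 3
  match k with
  | 0 => q₁ * p₁ - q₂ * p₂
  | 1 => 2 * p₁ * (q₂ * p₂ - p₁ * q₁) + q₂ ^ (d + 1) / Real.sqrt q₁
  | 2 => p₁ ^ 2 + q₂ ^ (d + 1) / (d + 1)
  | 3 => (p₁ * q₁ - p₂ * q₂) ^ 2 - 2 * q₂ ^ (d + 1) / q₁ ^ (d + 1)

/-- The solution `H₂`, as a function of the values `h` of `H₁` and `i` of `I₂`. -/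
noncomputable def rowH (k : Fin 4) (α h i : ℝ) : ℝ :=
  match k with
  | 0 => 0
  | 1 => i ^ (-1 / α)
  | 2 => i ^ (-1 / (2 * α))
  | 3 => i * h ^ (-1 / (2 * α))

/-- The condition under which the real power in `rowH` is taken of a positive number. -/
def rowPos (k : Fin 4) (h i : ℝ) : Prop :=
  match k with
  | 0 => True
  | 1 => 0 < i
  | 2 => 0 < i
  | 3 => 0 < h

/-- The phase-space domain of `H₂` in row `k`. -/
def rowDom (k : Fin 4) (d : ℝ) : Set Phase :=
  {x | x ∈ phaseOver quadrant ∧ rowPos k (ham (rowV k d) x) (rowI k d x)}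

/-- `V` is the potential of row `k` with exponent `d`, and `α, β, d` satisfy the relation of that
row. For `d = -1` the potential `V = 1 / (q₁ q₂)` (common to the rows `0` and `3`) arises from all
`α, β`, so that only the potential can be compared. -/
def IsRow (V : ℝ → ℝ → ℝ) (k : Fin 4) (α β d : ℝ) : Prop :=
  (∀ q₁ q₂ : ℝ, 0 < q₁ → 0 < q₂ → V q₁ q₂ = rowV k d q₁ q₂) ∧ (d ≠ -1 → rowRel k α β d)

/-- The monomial potential belongs to one of the four families, possibly after the permutation of
the pairs `(q₁, p₁)` and `(q₂, p₂)`, which exchanges `α` with `β` and `d` with `expo α β d`. -/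
def InTable (α β d : ℝ) : Prop :=
  ∃ k : Fin 4, IsRow (monoV α β d) k α β d ∨
    IsRow (fun q₁ q₂ => monoV α β d q₂ q₁) k β α (expo α β d)

end BiHam

/-! Write `X` for the Hamiltonian field of `H₁`, `S = (αq₁, βq₂, -αp₁, -βp₂)` for the scaling field
generated by `ρ`, and `e` for the exponent of `q₁`. The bivector `P'` is the wedge of these two
fields: `P' dF = S(F) X - X(F) S` (`secondBivector_mulVec`). Hence (*) follows from `X(H₂) = 0` and
`S(H₂) = κ₂H₂`. Conversely, (*) forces `X(H₂) = 0` wherever `αq₁p₁ ≠ βq₂p₂`, hence everywhere by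
continuity (`flow_eq_zero_of_solvesBiHam`). Solutions are thus first integrals, and an integral that
is homogeneous for `S` is a solution with its weight as `κ₂`.

The choice of `e` is exactly the condition `α(e+1) + β(d+1) = 0`, which makes `H₁` homogeneous of
weight `-(α+β)`. The listed integrals have weights `0, -α, -2α, 0`. A nonzero weight `κ` is
normalised to `1` by the power `1/κ`; in family 4 the missing weight is supplied by a power of `H₁`.
In family 1 both `H₁` and `I₂` have weight `0`, so a function of them has weight `0`; if it also has
weight `1` it vanishes.

For the classification, let `ap₁² + bp₁p₂ + cp₂² + lp₁ + mp₂ + f` be an integral. The determining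
equations make `a`, `l` independent of `q₂`, make `c`, `m` independent of `q₁`, and give `∂₂b =
-∂₁a`, `∂₁b = -∂₂c`. The mixed derivatives of `b` then give `a'' = c''`, a locally constant
function, and those of `f` give `e q₂²(3q₁a' + 2(e-1)a) = d q₁²(3q₂c' + 2(d-1)c)`. Unless `e = d`,
`e + d = -2`, or one of `e`, `d` lies in `{1, -1/2}`, these force `a = c = 0` and `l = m = 0`
(`quadratic_part_eq_zero`, `linear_part_eq_zero`), and then `dI = (b/2) dH₁`. The exceptional
exponents are those of the four families, up to exchange of the coordinate pairs
(`inTable_of_exponents`). Every step is a pointwise identity between derivatives, with no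
integration, so `D` need not be connected. -/

namespace BiHam

/-! ### Functions quadratic in the momenta -/

/-- The function on phase space with coefficients `a, b, c, l, m, f`, quadratic in the momenta. -/
def quad (a b c l m f : ℝ × ℝ → ℝ) (x : Phase) : ℝ :=
  a (x 0, x 1) * x 2 ^ 2 + b (x 0, x 1) * (x 2 * x 3) + c (x 0, x 1) * x 3 ^ 2
    + l (x 0, x 1) * x 2 + m (x 0, x 1) * x 3 + f (x 0, x 1)

/-- The projection of phase space to the configuration plane. -/
noncomputable def base : Phase →L[ℝ] ℝ × ℝ :=
  (ContinuousLinearMap.proj 0).prod (ContinuousLinearMap.proj 1)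

@[simp] lemma base_apply (x : Phase) : base x = (x 0, x 1) := rfl

lemma isOpen_quadrant : IsOpen quadrant :=
  (isOpen_lt continuous_const continuous_fst).inter (isOpen_lt continuous_const continuous_snd)

lemma isOpen_phaseOver {D : Set (ℝ × ℝ)} (hD : IsOpen D) : IsOpen (phaseOver D) :=
  hD.preimage base.continuous

lemma phaseOver_mono {D E : Set (ℝ × ℝ)} (h : D ⊆ E) : phaseOver D ⊆ phaseOver E :=
  fun _ hx => h hx

lemma quad_fderiv {a b c l m f : ℝ × ℝ → ℝ} {x : Phase}
    (ha : DifferentiableAt ℝ a (x 0, x 1)) (hb : DifferentiableAt ℝ b (x 0, x 1))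
    (hc : DifferentiableAt ℝ c (x 0, x 1)) (hl : DifferentiableAt ℝ l (x 0, x 1))
    (hm : DifferentiableAt ℝ m (x 0, x 1)) (hf : DifferentiableAt ℝ f (x 0, x 1)) (v : Phase) :
    fderiv ℝ (quad a b c l m f) x v =
      fderiv ℝ a (x 0, x 1) (v 0, v 1) * x 2 ^ 2
      + fderiv ℝ b (x 0, x 1) (v 0, v 1) * (x 2 * x 3)
      + fderiv ℝ c (x 0, x 1) (v 0, v 1) * x 3 ^ 2
      + fderiv ℝ l (x 0, x 1) (v 0, v 1) * x 2 + fderiv ℝ m (x 0, x 1) (v 0, v 1) * x 3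
      + fderiv ℝ f (x 0, x 1) (v 0, v 1)
      + (2 * a (x 0, x 1) * x 2 + b (x 0, x 1) * x 3 + l (x 0, x 1)) * v 2
      + (b (x 0, x 1) * x 2 + 2 * c (x 0, x 1) * x 3 + m (x 0, x 1)) * v 3 := by
  have key : ∀ {g : ℝ × ℝ → ℝ}, DifferentiableAt ℝ g (x 0, x 1) →
      HasFDerivAt (fun y : Phase => g (y 0, y 1)) ((fderiv ℝ g (x 0, x 1)).comp base) x :=
    fun {g} hg => HasFDerivAt.comp (f := base) (g := g) x hg.hasFDerivAt base.hasFDerivAt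
  have h2 : HasFDerivAt (fun y : Phase => y 2) (ContinuousLinearMap.proj (R := ℝ) 2) x :=
    (ContinuousLinearMap.proj (R := ℝ) (φ := fun _ : Fin 4 => ℝ) 2).hasFDerivAt
  have h3 : HasFDerivAt (fun y : Phase => y 3) (ContinuousLinearMap.proj (R := ℝ) 3) x :=
    (ContinuousLinearMap.proj (R := ℝ) (φ := fun _ : Fin 4 => ℝ) 3).hasFDerivAt
  have h := (((((key ha).mul (h2.pow 2)).add ((key hb).mul (h2.mul h3))).add
    ((key hc).mul (h3.pow 2))).add ((key hl).mul h2)).add ((key hm).mul h3) |>.add (key hf)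
  rw [show fderiv ℝ (quad a b c l m f) x = _ from h.fderiv]
  simp
  ring

lemma fderiv_pair (g : ℝ × ℝ → ℝ) (q : ℝ × ℝ) (s t : ℝ) :
    fderiv ℝ g q (s, t) = s * fderiv ℝ g q (1, 0) + t * fderiv ℝ g q (0, 1) := by
  have : (s, t) = s • ((1, 0) : ℝ × ℝ) + t • ((0, 1) : ℝ × ℝ) := by simp
  rw [this, map_add, map_smul, map_smul, smul_eq_mul, smul_eq_mul]

lemma fderiv_apply_eq (F : Phase → ℝ) (x v : Phase) :
    fderiv ℝ F x v = v 0 * partialD F 0 x + v 1 * partialD F 1 x + v 2 * partialD F 2 x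
      + v 3 * partialD F 3 x := by
  have : v = ∑ i, v i • (Pi.single i 1 : Phase) := by
    ext j; simp [Finset.sum_apply, Pi.single_apply]
  conv_lhs => rw [this]
  simp [Fin.sum_univ_four, partialD]

lemma contDiffOn_comp_base {D : Set (ℝ × ℝ)} {g : ℝ × ℝ → ℝ} (hg : ContDiffOn ℝ ∞ g D) :
    ContDiffOn ℝ ∞ (fun x : Phase => g (x 0, x 1)) (phaseOver D) :=
  hg.comp (f := base) base.contDiff.contDiffOn (fun _ hx => hx)

lemma polyInMomenta_two_iff {D : Set (ℝ × ℝ)} {F : Phase → ℝ} :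
    PolyInMomenta 2 D F ↔ ∃ a b c l m f : ℝ × ℝ → ℝ,
      (ContDiffOn ℝ ∞ a D ∧ ContDiffOn ℝ ∞ b D ∧ ContDiffOn ℝ ∞ c D ∧ ContDiffOn ℝ ∞ l D ∧
        ContDiffOn ℝ ∞ m D ∧ ContDiffOn ℝ ∞ f D) ∧ ∀ x ∈ phaseOver D, F x = quad a b c l m f x := by
  constructor
  · rintro ⟨g, hg, h⟩
    -- The first index of `g` is the power of `p₂`, the second that of `p₁`.
    refine ⟨g 0 2, g 1 1, g 2 0, g 0 1, g 1 0, g 0 0,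
      ⟨hg _ _, hg _ _, hg _ _, hg _ _, hg _ _, hg _ _⟩, fun x hx => ?_⟩
    rw [h x hx]
    simp [Finset.sum_range_succ, quad]
    ring
  · rintro ⟨a, b, c, l, m, f, ⟨ha, hb, hc, hl, hm, hf⟩, h⟩
    refine ⟨fun k n => match k, n with
      | 0, 0 => f | 0, 1 => l | 0, 2 => a | 1, 0 => m | 1, 1 => b | 2, 0 => c | _, _ => 0,
      fun k n => ?_, fun x hx => ?_⟩
    · beta_reduce
      split <;> first | assumption | exact contDiffOn_const
    · rw [h x hx]
      simp [Finset.sum_range_succ, quad]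
      ring

lemma PolyInMomenta.mono {M : ℕ} {D E : Set (ℝ × ℝ)} {F : Phase → ℝ} (h : PolyInMomenta M E F)
    (hDE : D ⊆ E) : PolyInMomenta M D F := by
  obtain ⟨g, hg, hF⟩ := h
  exact ⟨g, fun k m => (hg k m).mono hDE, fun x hx => hF x (hDE hx)⟩

lemma PolyInMomenta.contDiffOn {M : ℕ} {D : Set (ℝ × ℝ)} {F : Phase → ℝ}
    (h : PolyInMomenta M D F) : ContDiffOn ℝ ∞ F (phaseOver D) := by
  obtain ⟨g, hg, hF⟩ := h
  refine ContDiffOn.congr (ContDiffOn.sum fun k _ => ContDiffOn.sum fun m _ => ?_) hF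
  exact ((contDiffOn_comp_base (hg k m)).mul ((contDiff_apply ℝ ℝ (2 : Fin 4)).pow m).contDiffOn).mul
    ((contDiff_apply ℝ ℝ (3 : Fin 4)).pow k).contDiffOn

lemma PolyInMomenta.differentiableAt {M : ℕ} {D : Set (ℝ × ℝ)} {F : Phase → ℝ}
    (h : PolyInMomenta M D F) (hD : IsOpen D) {x : Phase} (hx : x ∈ phaseOver D) :
    DifferentiableAt ℝ F x :=
  (h.contDiffOn.contDiffAt ((isOpen_phaseOver hD).mem_nhds hx)).differentiableAt (by simp)

lemma fderiv_eq_of_eqOn {E : Type*} [NormedAddCommGroup E] [NormedSpace ℝ E] {F G : E → ℝ}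
    {U : Set E} (hU : IsOpen U) (h : ∀ x ∈ U, F x = G x) {x : E} (hx : x ∈ U) :
    fderiv ℝ F x = fderiv ℝ G x :=
  Filter.EventuallyEq.fderiv_eq (Filter.mem_of_superset (hU.mem_nhds hx) h)

/-! ### The monomial Hamiltonian -/

/-- The monomial `q₁ ^ s * q₂ ^ t`. -/
noncomputable def mono (s t : ℝ) (q : ℝ × ℝ) : ℝ := q.1 ^ s * q.2 ^ t

lemma mono_contDiffOn (s t : ℝ) : ContDiffOn ℝ ∞ (mono s t) quadrant :=
  (contDiff_fst.contDiffOn.rpow_const_of_ne fun _ hq => hq.1.ne').mul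
    (contDiff_snd.contDiffOn.rpow_const_of_ne fun _ hq => hq.2.ne')

lemma differentiableAt_of_contDiffOn {E : Type*} [NormedAddCommGroup E] [NormedSpace ℝ E]
    {g : E → ℝ} {U : Set E} (hU : IsOpen U) (hg : ContDiffOn ℝ ∞ g U) {q : E} (hq : q ∈ U) :
    DifferentiableAt ℝ g q :=
  (hg.contDiffAt (hU.mem_nhds hq)).differentiableAt (by simp)

lemma mono_pos {s t : ℝ} {q : ℝ × ℝ} (hq : q ∈ quadrant) : 0 < mono s t q :=
  mul_pos (Real.rpow_pos_of_pos hq.1 _) (Real.rpow_pos_of_pos hq.2 _)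

lemma mono_fderiv {s t : ℝ} {q : ℝ × ℝ} (hq : q ∈ quadrant) (v : ℝ × ℝ) :
    fderiv ℝ (mono s t) q v = s * mono s t q / q.1 * v.1 + t * mono s t q / q.2 * v.2 := by
  have h1 : HasFDerivAt (fun q : ℝ × ℝ => q.1) (ContinuousLinearMap.fst ℝ ℝ ℝ) q := hasFDerivAt_fst
  have h2 : HasFDerivAt (fun q : ℝ × ℝ => q.2) (ContinuousLinearMap.snd ℝ ℝ ℝ) q := hasFDerivAt_snd
  have h := (h1.rpow_const (p := s) (Or.inl hq.1.ne')).mul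
    (h2.rpow_const (p := t) (Or.inl hq.2.ne'))
  rw [show fderiv ℝ (mono s t) q = _ from h.fderiv]
  simp only [mono, Real.rpow_sub_one hq.1.ne', Real.rpow_sub_one hq.2.ne']
  simp
  ring

lemma monoV_eq (α β d q₁ q₂ : ℝ) : monoV α β d q₁ q₂ = mono (expo α β d) d (q₁, q₂) := rfl

lemma ham_monoV (α β d : ℝ) : ham (monoV α β d) =
    quad (fun _ => 0) (fun _ => 2) (fun _ => 0) (fun _ => 0) (fun _ => 0)
      (mono (expo α β d) d) := by
  ext x; simp [ham, quad, monoV_eq]; ring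

lemma ham_polyInMomenta (α β d : ℝ) : PolyInMomenta 2 quadrant (ham (monoV α β d)) :=
  polyInMomenta_two_iff.2 ⟨_, _, _, _, _, _, ⟨contDiffOn_const, contDiffOn_const, contDiffOn_const,
    contDiffOn_const, contDiffOn_const, mono_contDiffOn _ _⟩, fun x _ => by rw [ham_monoV]⟩

lemma ham_fderiv {α β d : ℝ} {x : Phase} (hx : x ∈ phaseOver quadrant) (v : Phase) :
    fderiv ℝ (ham (monoV α β d)) x v =
      expo α β d * mono (expo α β d) d (x 0, x 1) / x 0 * v 0
        + d * mono (expo α β d) d (x 0, x 1) / x 1 * v 1 + 2 * x 3 * v 2 + 2 * x 2 * v 3 := by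
  rw [ham_monoV, quad_fderiv (differentiableAt_const _) (differentiableAt_const _)
    (differentiableAt_const _) (differentiableAt_const _) (differentiableAt_const _)
    (differentiableAt_of_contDiffOn isOpen_quadrant (mono_contDiffOn _ _) hx), mono_fderiv hx]
  simp

/-- The Hamiltonian vector field of `2 p₁ p₂ + q₁ ^ e * q₂ ^ d`. -/
noncomputable def flowField (e d : ℝ) (x : Phase) : Phase :=
  ![2 * x 3, 2 * x 2, -(e * mono e d (x 0, x 1) / x 0), -(d * mono e d (x 0, x 1) / x 1)]

/-- The Hamiltonian vector field of `ρ = α p₁ q₁ + β p₂ q₂`. -/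
def scaleField (α β : ℝ) (x : Phase) : Phase :=
  ![α * x 0, β * x 1, -(α * x 2), -(β * x 3)]

lemma dV₁_monoV {α β d : ℝ} {q₁ q₂ : ℝ} (h₁ : 0 < q₁) :
    dV₁ (monoV α β d) q₁ q₂ = expo α β d * mono (expo α β d) d (q₁, q₂) / q₁ := by
  have h := (Real.hasDerivAt_rpow_const (p := expo α β d) (Or.inl h₁.ne')).mul_const (q₂ ^ d)
  rw [show dV₁ (monoV α β d) q₁ q₂ = _ from h.deriv, Real.rpow_sub_one h₁.ne', mono]
  ring

lemma dV₂_monoV {α β d : ℝ} {q₁ q₂ : ℝ} (h₂ : 0 < q₂) :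
    dV₂ (monoV α β d) q₁ q₂ = d * mono (expo α β d) d (q₁, q₂) / q₂ := by
  have h := (Real.hasDerivAt_rpow_const (p := d) (Or.inl h₂.ne')).const_mul (q₁ ^ expo α β d)
  rw [show dV₂ (monoV α β d) q₁ q₂ = _ from h.deriv, Real.rpow_sub_one h₂.ne', mono]
  ring

lemma hamField_monoV {α β d : ℝ} {x : Phase} (hx : x ∈ phaseOver quadrant) :
    hamField (monoV α β d) x = flowField (expo α β d) d x := by
  rw [hamField, flowField, dV₁_monoV hx.1, dV₂_monoV hx.2]

lemma bracket_monoV {α β d : ℝ} {x : Phase} (hx : x ∈ phaseOver quadrant) (F : Phase → ℝ) :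
    bracket (ham (monoV α β d)) F x = -fderiv ℝ F x (flowField (expo α β d) d x) := by
  rw [fderiv_apply_eq]
  simp only [bracket, partialD, ham_fderiv hx, flowField]
  simp
  ring

/-- The second bivector is the wedge product of the two Hamiltonian vector fields. -/
lemma secondBivector_mulVec {α β d : ℝ} {x : Phase} (hx : x ∈ phaseOver quadrant)
    (F : Phase → ℝ) :
    (secondBivector α β (monoV α β d) x).mulVec (grad F x) =
      fderiv ℝ F x (scaleField α β x) • flowField (expo α β d) d x
        - fderiv ℝ F x (flowField (expo α β d) d x) • scaleField α β x := by
  rw [fderiv_apply_eq, fderiv_apply_eq]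
  ext i
  fin_cases i <;>
  simp [secondBivector, Matrix.mulVec, dotProduct, Fin.sum_univ_four, grad, flowField, scaleField,
    dV₁_monoV hx.1, dV₂_monoV hx.2] <;> ring

/-- The easy half of the reduction: in `S(H) X - X(H) S` the second term drops out and the first is
`κ H X`. No genericity of the point is needed. -/
lemma solvesBiHam_of_fderiv {α β κ d : ℝ} {H : Phase → ℝ} {W : Set Phase}
    (hW : W ⊆ phaseOver quadrant) (hs : ContDiffOn ℝ ∞ H W)
    (hflow : ∀ x ∈ W, fderiv ℝ H x (flowField (expo α β d) d x) = 0)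
    (hscale : ∀ x ∈ W, fderiv ℝ H x (scaleField α β x) = κ * H x) :
    SolvesBiHam α β κ (monoV α β d) H W := by
  refine ⟨hs, fun x hx => ?_⟩
  rw [secondBivector_mulVec (hW hx), hflow x hx, hscale x hx, hamField_monoV (hW hx)]
  simp

lemma ham_flow {α β d : ℝ} {x : Phase} (hx : x ∈ phaseOver quadrant) :
    fderiv ℝ (ham (monoV α β d)) x (flowField (expo α β d) d x) = 0 := by
  rw [ham_fderiv hx]; simp [flowField]; ring

/-- The form of the definition of `e` that is symmetric in the two coordinate pairs. It says that
the weight `αe + βd` of `V` equals the weight `-(α+β)` of `p₁p₂`. -/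
lemma expo_relation {α : ℝ} (β d : ℝ) (hα : α ≠ 0) :
    α * (expo α β d + 1) + β * (d + 1) = 0 := by
  rw [expo]; field_simp; ring

lemma ham_scale {α β d : ℝ} (hα : α ≠ 0) {x : Phase} (hx : x ∈ phaseOver quadrant) :
    fderiv ℝ (ham (monoV α β d)) x (scaleField α β x) = -(α + β) * ham (monoV α β d) x := by
  have h1 : x 0 ≠ 0 := hx.1.ne'
  have h2 : x 1 ≠ 0 := hx.2.ne'
  rw [ham_fderiv hx]
  simp only [scaleField, ham, monoV_eq]
  simp
  field_simp
  linear_combination mono (expo α β d) d (x 0, x 1) * expo_relation β d hα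

/-- A `2 × 2` minor detects the independence of a function from the Hamiltonian. -/
lemma indepAt_of_minor {α β d : ℝ} {x : Phase} (hx : x ∈ phaseOver quadrant) {F : Phase → ℝ}
    (h : x 3 * partialD F 3 x - x 2 * partialD F 2 x ≠ 0) : IndepAt (ham (monoV α β d)) F x := by
  rw [IndepAt, LinearIndependent.pair_iff]
  intro s t hst
  have e2 := DFunLike.congr_fun hst (Pi.single 2 1)
  have e3 := DFunLike.congr_fun hst (Pi.single 3 1)
  simp [ham_fderiv hx] at e2 e3
  simp only [partialD] at h
  have ht : t = 0 := by
    refine (mul_eq_zero.1 ?_).resolve_right h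
    linear_combination x 3 * e3 - x 2 * e2
  subst ht
  refine ⟨?_, rfl⟩
  by_contra hs
  have h3 : x 3 = 0 := by simpa [hs] using e2
  have h2 : x 2 = 0 := by simpa [hs] using e3
  simp [h2, h3] at h

/-! ### Shifting the first momentum -/

/-- The point with first momentum increased by `t`. -/
noncomputable def shift (x : Phase) (t : ℝ) : Phase := x + t • Pi.single 2 1

@[simp] lemma shift_zero (x : Phase) (t : ℝ) : shift x t 0 = x 0 := by simp [shift]
@[simp] lemma shift_one (x : Phase) (t : ℝ) : shift x t 1 = x 1 := by simp [shift]
@[simp] lemma shift_two (x : Phase) (t : ℝ) : shift x t 2 = x 2 + t := by simp [shift]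
@[simp] lemma shift_three (x : Phase) (t : ℝ) : shift x t 3 = x 3 := by simp [shift]

lemma tendsto_shift (x : Phase) :
    Filter.Tendsto (shift x) (nhdsWithin 0 {0}ᶜ) (nhds x) := by
  have h : Continuous (shift x) := by unfold shift; fun_prop
  simpa [shift] using h.continuousAt.tendsto.mono_left (nhdsWithin_le_nhds (a := (0 : ℝ)))

/-- Each degenerate locus that has to be avoided is affine in `p₁` with nonzero leading coefficient,
so at most one shift meets it. -/
lemma eventually_shift_ne (x : Phase) {r : ℝ} (hr : r ≠ 0) (s : ℝ) :
    ∀ᶠ t in nhdsWithin (0 : ℝ) {0}ᶜ, r * shift x t 2 ≠ s := by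
  have h : ∀ᶠ t in nhdsWithin (0 : ℝ) {0}ᶜ, t ≠ s / r - x 2 := by
    by_cases h0 : s / r - x 2 = 0
    · rw [h0]; exact self_mem_nhdsWithin
    · exact nhdsWithin_le_nhds (isOpen_ne.mem_nhds (Ne.symm h0))
  filter_upwards [h] with t ht hts
  apply ht
  rw [← hts]
  simp
  field_simp
  ring

/-! ### Iterated partial derivatives on an open set of configurations -/

lemma contDiffOn_fderiv_apply {D : Set (ℝ × ℝ)} (hD : IsOpen D) {g : ℝ × ℝ → ℝ}
    (hg : ContDiffOn ℝ ∞ g D) (v : ℝ × ℝ) : ContDiffOn ℝ ∞ (fun q => fderiv ℝ g q v) D :=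
  (hg.fderiv_of_isOpen hD (m := ∞) (by simp)).clm_apply contDiffOn_const

lemma fderiv_apply_comm {D : Set (ℝ × ℝ)} (hD : IsOpen D) {g : ℝ × ℝ → ℝ}
    (hg : ContDiffOn ℝ ∞ g D) {q : ℝ × ℝ} (hq : q ∈ D) (v w : ℝ × ℝ) :
    fderiv ℝ (fun q => fderiv ℝ g q v) q w = fderiv ℝ (fun q => fderiv ℝ g q w) q v := by
  have hd : DifferentiableAt ℝ (fderiv ℝ g) q :=
    ((hg.fderiv_of_isOpen hD (m := ∞) (by simp)).contDiffAt (hD.mem_nhds hq)).differentiableAt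
      (by simp)
  have hs : IsSymmSndFDerivAt ℝ g q :=
    (hg.contDiffAt (hD.mem_nhds hq)).isSymmSndFDerivAt (by
      simp only [minSmoothness_of_isRCLikeNormedField]; exact WithTop.coe_le_coe.2 le_top)
  rw [fderiv_clm_apply hd (differentiableAt_const v), fderiv_clm_apply hd (differentiableAt_const w)]
  simpa using hs w v

lemma fderiv_apply_eq_zero {D : Set (ℝ × ℝ)} (hD : IsOpen D) {g : ℝ × ℝ → ℝ}
    (hg : ∀ q ∈ D, g q = 0) {q : ℝ × ℝ} (hq : q ∈ D) (v : ℝ × ℝ) : fderiv ℝ g q v = 0 := by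
  rw [fderiv_eq_of_eqOn hD (G := fun _ => 0) hg hq]; simp

lemma fderiv_apply_of_eqOn {D : Set (ℝ × ℝ)} (hD : IsOpen D) {g h : ℝ × ℝ → ℝ}
    {h' : ℝ × ℝ →L[ℝ] ℝ} {q : ℝ × ℝ} (hh : HasFDerivAt h h' q) (hgh : ∀ q ∈ D, g q = h q)
    (hq : q ∈ D) (v : ℝ × ℝ) : fderiv ℝ g q v = h' v := by
  rw [fderiv_eq_of_eqOn hD hgh hq, hh.fderiv]

lemma apply_eq_zero_of_eqOn {D : Set (ℝ × ℝ)} (hD : IsOpen D) {g : ℝ × ℝ → ℝ}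
    {g' : ℝ × ℝ →L[ℝ] ℝ} {q : ℝ × ℝ} (hh : HasFDerivAt g g' q) (hg : ∀ q ∈ D, g q = 0)
    (hq : q ∈ D) (v : ℝ × ℝ) : g' v = 0 := by
  rw [← hh.fderiv]; exact fderiv_apply_eq_zero hD hg hq v

/-! ### The determining equations of a quadratic integral -/

/-- Ten evaluations determine the ten coefficients: the chosen points make the linear system
invertible. -/
lemma cubic_coeff_eq_zero {k₃₀ k₂₁ k₁₂ k₀₃ k₂₀ k₁₁ k₀₂ k₁₀ k₀₁ k₀₀ : ℝ}
    (h : ∀ s t : ℝ, k₃₀ * s ^ 3 + k₂₁ * s ^ 2 * t + k₁₂ * s * t ^ 2 + k₀₃ * t ^ 3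
      + k₂₀ * s ^ 2 + k₁₁ * s * t + k₀₂ * t ^ 2 + k₁₀ * s + k₀₁ * t + k₀₀ = 0) :
    (k₃₀ = 0 ∧ k₂₁ = 0 ∧ k₁₂ = 0 ∧ k₀₃ = 0) ∧ (k₂₀ = 0 ∧ k₁₁ = 0 ∧ k₀₂ = 0) ∧
      (k₁₀ = 0 ∧ k₀₁ = 0) ∧ k₀₀ = 0 := by
  have h00 := h 0 0
  have h10 := h 1 0
  have h20 := h (-1) 0
  have h30 := h 2 0
  have h01 := h 0 1
  have h02 := h 0 (-1)
  have h03 := h 0 2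
  have h11 := h 1 1
  have h12 := h 1 (-1)
  have h21 := h (-1) 1
  refine ⟨⟨?_, ?_, ?_, ?_⟩, ⟨?_, ?_, ?_⟩, ⟨?_, ?_⟩, ?_⟩ <;> linarith

/-- The determining equations for the coefficients of a quadratic integral of
`2 p₁ p₂ + q₁ ^ e * q₂ ^ d`, at one configuration. -/
lemma determining_equations {e d : ℝ} {D : Set (ℝ × ℝ)} (hD : IsOpen D) {a b c l m f : ℝ × ℝ → ℝ}
    (ha : ContDiffOn ℝ ∞ a D) (hb : ContDiffOn ℝ ∞ b D) (hc : ContDiffOn ℝ ∞ c D)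
    (hl : ContDiffOn ℝ ∞ l D) (hm : ContDiffOn ℝ ∞ m D) (hf : ContDiffOn ℝ ∞ f D)
    (hflow : ∀ x ∈ phaseOver D, fderiv ℝ (quad a b c l m f) x (flowField e d x) = 0)
    {q : ℝ × ℝ} (hq : q ∈ D) :
    (fderiv ℝ a q (0, 1) = 0 ∧ fderiv ℝ b q (0, 1) = -fderiv ℝ a q (1, 0) ∧
      fderiv ℝ b q (1, 0) = -fderiv ℝ c q (0, 1) ∧ fderiv ℝ c q (1, 0) = 0) ∧
    (fderiv ℝ l q (0, 1) = 0 ∧ fderiv ℝ m q (0, 1) = -fderiv ℝ l q (1, 0) ∧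
      fderiv ℝ m q (1, 0) = 0) ∧
    (fderiv ℝ f q (0, 1) = a q * (e * mono e d q / q.1) + b q * (d * mono e d q / q.2) / 2 ∧
      fderiv ℝ f q (1, 0) = b q * (e * mono e d q / q.1) / 2 + c q * (d * mono e d q / q.2)) ∧
    l q * (e * mono e d q / q.1) + m q * (d * mono e d q / q.2) = 0 := by
  -- `kᵢⱼ` is the coefficient of `p₁ⁱp₂ʲ` in the derivative along the flow. Degrees 3 and 1 involve
  -- only `a, b, c, f`, degrees 2 and 0 only `l, m`, so the two parts decouple.
  have key := cubic_coeff_eq_zero (k₃₀ := 2 * fderiv ℝ a q (0, 1))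
    (k₂₁ := 2 * fderiv ℝ a q (1, 0) + 2 * fderiv ℝ b q (0, 1))
    (k₁₂ := 2 * fderiv ℝ b q (1, 0) + 2 * fderiv ℝ c q (0, 1))
    (k₀₃ := 2 * fderiv ℝ c q (1, 0)) (k₂₀ := 2 * fderiv ℝ l q (0, 1))
    (k₁₁ := 2 * fderiv ℝ l q (1, 0) + 2 * fderiv ℝ m q (0, 1)) (k₀₂ := 2 * fderiv ℝ m q (1, 0))
    (k₁₀ := 2 * fderiv ℝ f q (0, 1) - 2 * a q * (e * mono e d q / q.1)
      - b q * (d * mono e d q / q.2))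
    (k₀₁ := 2 * fderiv ℝ f q (1, 0) - b q * (e * mono e d q / q.1)
      - 2 * c q * (d * mono e d q / q.2))
    (k₀₀ := -(l q * (e * mono e d q / q.1) + m q * (d * mono e d q / q.2))) (by
      intro s t
      have hx : (![q.1, q.2, s, t] : Phase) ∈ phaseOver D := by simpa [phaseOver] using hq
      have h := hflow _ hx
      rw [quad_fderiv (differentiableAt_of_contDiffOn hD ha hx)
        (differentiableAt_of_contDiffOn hD hb hx) (differentiableAt_of_contDiffOn hD hc hx)
        (differentiableAt_of_contDiffOn hD hl hx) (differentiableAt_of_contDiffOn hD hm hx)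
        (differentiableAt_of_contDiffOn hD hf hx)] at h
      simp [flowField] at h
      rw [fderiv_pair a, fderiv_pair b, fderiv_pair c, fderiv_pair l, fderiv_pair m,
        fderiv_pair f] at h
      linear_combination h)
  obtain ⟨⟨h1, h2, h3, h4⟩, ⟨h5, h6, h7⟩, ⟨h8, h9⟩, h10⟩ := key
  refine ⟨⟨?_, ?_, ?_, ?_⟩, ⟨?_, ?_, ?_⟩, ⟨?_, ?_⟩, ?_⟩ <;> linarith

/-- The linear part of an integral vanishes unless the two exponents agree. -/
lemma linear_part_eq_zero {e d : ℝ} (he : e ≠ 0) (hd : d ≠ 0) (hed : e ≠ d) {D : Set (ℝ × ℝ)}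
    (hD : IsOpen D) (hDq : D ⊆ quadrant) {l m : ℝ × ℝ → ℝ}
    (hl : ContDiffOn ℝ ∞ l D) (hm : ContDiffOn ℝ ∞ m D)
    (hl2 : ∀ q ∈ D, fderiv ℝ l q (0, 1) = 0)
    (hm2 : ∀ q ∈ D, fderiv ℝ m q (0, 1) = -fderiv ℝ l q (1, 0))
    (hm1 : ∀ q ∈ D, fderiv ℝ m q (1, 0) = 0)
    (h : ∀ q ∈ D, l q * (e * mono e d q / q.1) + m q * (d * mono e d q / q.2) = 0) :
    ∀ q ∈ D, l q = 0 ∧ m q = 0 := by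
  have hE : ∀ q ∈ D, e * (l q * q.2) + d * (m q * q.1) = 0 := by
    intro q hq
    have h1 : q.1 ≠ 0 := (hDq hq).1.ne'
    have h2 : q.2 ≠ 0 := (hDq hq).2.ne'
    have hM := (mono_pos (s := e) (t := d) (hDq hq)).ne'
    have := h q hq
    field_simp at this
    refine mul_left_cancel₀ hM ?_
    linear_combination this
  -- The relation `e l q₂ + d m q₁ = 0` is differentiated in each variable. The `q₁`-derivative `e
  -- q₂ l' + d m = 0`, differentiated once more in `q₂` with `m' = -l'`, leaves `(e - d) l' = 0`.
  have hder : ∀ q ∈ D, ∀ v : ℝ × ℝ, e * (l q * v.2 + q.2 * fderiv ℝ l q v)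
      + d * (m q * v.1 + q.1 * fderiv ℝ m q v) = 0 := by
    intro q hq v
    have hlq := (differentiableAt_of_contDiffOn hD hl hq).hasFDerivAt
    have hmq := (differentiableAt_of_contDiffOn hD hm hq).hasFDerivAt
    have := apply_eq_zero_of_eqOn hD (((hlq.mul hasFDerivAt_snd).const_mul e).add
      ((hmq.mul hasFDerivAt_fst).const_mul d)) hE hq v
    simp at this
    linear_combination this
  have hder' : ∀ q ∈ D, e * l q - d * q.1 * fderiv ℝ l q (1, 0) = 0 := by
    intro q hq
    have := hder q hq (0, 1)
    rw [hl2 q hq, hm2 q hq] at this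
    linear_combination this
  have hl1 : ∀ q ∈ D, e * (q.2 * fderiv ℝ l q (1, 0)) + d * m q = 0 := by
    intro q hq
    have := hder q hq (1, 0)
    rw [hm1 q hq] at this
    linear_combination this
  have hzero : ∀ q ∈ D, fderiv ℝ l q (1, 0) = 0 := by
    intro q hq
    have hlq := (differentiableAt_of_contDiffOn hD (contDiffOn_fderiv_apply hD hl (1, 0))
      hq).hasFDerivAt
    have hmq := (differentiableAt_of_contDiffOn hD hm hq).hasFDerivAt
    have := apply_eq_zero_of_eqOn hD ((((hasFDerivAt_snd (p := q)).mul hlq).const_mul e).add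
      (hmq.const_mul d)) hl1 hq (0, 1)
    simp at this
    rw [hm2 q hq, fderiv_apply_comm hD hl hq, fderiv_apply_eq_zero hD hl2 hq] at this
    refine (mul_eq_zero.1 ?_).resolve_left (sub_ne_zero.2 hed)
    linear_combination this
  intro q hq
  have h1 := hder' q hq
  have h2 := hl1 q hq
  rw [hzero q hq] at h1 h2
  exact ⟨by simpa [he] using h1, by simpa [hd] using h2⟩

/-- The compatibility condition of the two equations for the potential part of an integral. -/
lemma compatibility {e d : ℝ} {D : Set (ℝ × ℝ)} (hD : IsOpen D) (hDq : D ⊆ quadrant)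
    {a b c f : ℝ × ℝ → ℝ} (ha : ContDiffOn ℝ ∞ a D) (hb : ContDiffOn ℝ ∞ b D)
    (hc : ContDiffOn ℝ ∞ c D) (hf : ContDiffOn ℝ ∞ f D)
    (hb2 : ∀ q ∈ D, fderiv ℝ b q (0, 1) = -fderiv ℝ a q (1, 0))
    (hb1 : ∀ q ∈ D, fderiv ℝ b q (1, 0) = -fderiv ℝ c q (0, 1))
    (hf2 : ∀ q ∈ D, fderiv ℝ f q (0, 1) =
      a q * (e * mono e d q / q.1) + b q * (d * mono e d q / q.2) / 2)
    (hf1 : ∀ q ∈ D, fderiv ℝ f q (1, 0) =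
      b q * (e * mono e d q / q.1) / 2 + c q * (d * mono e d q / q.2)) {q : ℝ × ℝ} (hq : q ∈ D) :
    e * (3 * (fderiv ℝ a q (1, 0) * (q.1 * q.2 ^ 2)) + 2 * (e - 1) * (a q * q.2 ^ 2))
      - d * (3 * (fderiv ℝ c q (0, 1) * (q.2 * q.1 ^ 2)) + 2 * (d - 1) * (c q * q.1 ^ 2)) = 0 := by
  have hM1 : ∀ q ∈ D, mono (e - 1) d q = mono e d q / q.1 := fun q hq => by
    rw [mono, mono, Real.rpow_sub_one (hDq hq).1.ne']; ring
  have hM2 : ∀ q ∈ D, mono e (d - 1) q = mono e d q / q.2 := fun q hq => by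
    rw [mono, mono, Real.rpow_sub_one (hDq hq).2.ne']; ring
  have h2 : ∀ q ∈ D, fderiv ℝ f q (0, 1) =
      e * (a q * mono (e - 1) d q) + d / 2 * (b q * mono e (d - 1) q) := fun q hq => by
    rw [hf2 q hq, hM1 q hq, hM2 q hq]; ring
  have h1 : ∀ q ∈ D, fderiv ℝ f q (1, 0) =
      e / 2 * (b q * mono (e - 1) d q) + d * (c q * mono e (d - 1) q) := fun q hq => by
    rw [hf1 q hq, hM1 q hq, hM2 q hq]; ring
  have haq := (differentiableAt_of_contDiffOn hD ha hq).hasFDerivAt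
  have hbq := (differentiableAt_of_contDiffOn hD hb hq).hasFDerivAt
  have hcq := (differentiableAt_of_contDiffOn hD hc hq).hasFDerivAt
  have hmon : ∀ s t : ℝ, HasFDerivAt (mono s t) (fderiv ℝ (mono s t) q) q := fun s t =>
    (differentiableAt_of_contDiffOn isOpen_quadrant (mono_contDiffOn s t) (hDq hq)).hasFDerivAt
  -- Symmetry of the second derivatives of `f`. The undifferentiated `b` enters both sides with the
  -- same coefficient and cancels; its derivatives are expressed through those of `a` and `c`.
  have key := fderiv_apply_comm hD hf hq (0, 1) (1, 0)
  rw [fderiv_apply_of_eqOn hD (((haq.mul (hmon (e - 1) d)).const_mul e).add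
      ((hbq.mul (hmon e (d - 1))).const_mul (d / 2))) h2 hq,
    fderiv_apply_of_eqOn hD (((hbq.mul (hmon (e - 1) d)).const_mul (e / 2)).add
      ((hcq.mul (hmon e (d - 1))).const_mul d)) h1 hq] at key
  simp [mono_fderiv (hDq hq), hM1 q hq, hM2 q hq, hb1 q hq, hb2 q hq] at key
  have hq1 : q.1 ≠ 0 := (hDq hq).1.ne'
  have hq2 : q.2 ≠ 0 := (hDq hq).2.ne'
  have hM := (mono_pos (s := e) (t := d) (hDq hq)).ne'
  field_simp at key
  linear_combination key

/-- Outside the exceptional exponents the quadratic part of an integral is a multiple of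
`p₁ p₂`. -/
lemma quadratic_part_eq_zero {e d : ℝ} (he : e ≠ 0) (hd : d ≠ 0) (hed : e ≠ d)
    (hed2 : e + d ≠ -2) (he1 : e ≠ 1) (heh : e ≠ -1 / 2) (hd1 : d ≠ 1) (hdh : d ≠ -1 / 2)
    {D : Set (ℝ × ℝ)} (hD : IsOpen D) (hDq : D ⊆ quadrant) {a b c : ℝ × ℝ → ℝ}
    (ha : ContDiffOn ℝ ∞ a D) (hb : ContDiffOn ℝ ∞ b D) (hc : ContDiffOn ℝ ∞ c D)
    (ha2 : ∀ q ∈ D, fderiv ℝ a q (0, 1) = 0) (hc1 : ∀ q ∈ D, fderiv ℝ c q (1, 0) = 0)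
    (hb2 : ∀ q ∈ D, fderiv ℝ b q (0, 1) = -fderiv ℝ a q (1, 0))
    (hb1 : ∀ q ∈ D, fderiv ℝ b q (1, 0) = -fderiv ℝ c q (0, 1))
    (hE : ∀ q ∈ D,
      e * (3 * (fderiv ℝ a q (1, 0) * (q.1 * q.2 ^ 2)) + 2 * (e - 1) * (a q * q.2 ^ 2))
      - d * (3 * (fderiv ℝ c q (0, 1) * (q.2 * q.1 ^ 2)) + 2 * (d - 1) * (c q * q.1 ^ 2)) = 0) :
    ∀ q ∈ D, a q = 0 ∧ c q = 0 := by
  set a₁ : ℝ × ℝ → ℝ := fun q => fderiv ℝ a q (1, 0) with ha₁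
  set c₂ : ℝ × ℝ → ℝ := fun q => fderiv ℝ c q (0, 1) with hc₂
  have hsa₁ : ContDiffOn ℝ ∞ a₁ D := contDiffOn_fderiv_apply hD ha _
  have hsc₂ : ContDiffOn ℝ ∞ c₂ D := contDiffOn_fderiv_apply hD hc _
  set a₁₁ : ℝ × ℝ → ℝ := fun q => fderiv ℝ a₁ q (1, 0) with ha₁₁
  set c₂₂ : ℝ × ℝ → ℝ := fun q => fderiv ℝ c₂ q (0, 1) with hc₂₂
  have hsa₁₁ : ContDiffOn ℝ ∞ a₁₁ D := contDiffOn_fderiv_apply hD hsa₁ _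
  have hsc₂₂ : ContDiffOn ℝ ∞ c₂₂ D := contDiffOn_fderiv_apply hD hsc₂ _
  have ha12 : ∀ q ∈ D, fderiv ℝ a₁ q (0, 1) = 0 := fun q hq => by
    rw [ha₁, fderiv_apply_comm hD ha hq]; exact fderiv_apply_eq_zero hD ha2 hq _
  have hc21 : ∀ q ∈ D, fderiv ℝ c₂ q (1, 0) = 0 := fun q hq => by
    rw [hc₂, fderiv_apply_comm hD hc hq]; exact fderiv_apply_eq_zero hD hc1 hq _
  -- Symmetry of the second derivatives of `b`. One side is independent of `q₂` and the other of
  -- `q₁`, so the common value has zero gradient.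
  have heq : ∀ q ∈ D, a₁₁ q = c₂₂ q := fun q hq => by
    have h := fderiv_apply_comm hD hb hq (0, 1) (1, 0)
    rw [fderiv_eq_of_eqOn hD (G := fun q => -a₁ q) hb2 hq,
      fderiv_eq_of_eqOn hD (G := fun q => -c₂ q) hb1 hq] at h
    simpa using h
  have ha112 : ∀ q ∈ D, fderiv ℝ a₁₁ q (0, 1) = 0 := fun q hq => by
    rw [ha₁₁, fderiv_apply_comm hD hsa₁ hq]; exact fderiv_apply_eq_zero hD ha12 hq _
  have hc221 : ∀ q ∈ D, fderiv ℝ c₂₂ q (1, 0) = 0 := fun q hq => by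
    rw [hc₂₂, fderiv_apply_comm hD hsc₂ hq]; exact fderiv_apply_eq_zero hD hc21 hq _
  have ha111 : ∀ q ∈ D, fderiv ℝ a₁₁ q (1, 0) = 0 := fun q hq => by
    rw [fderiv_eq_of_eqOn hD heq hq, hc221 q hq]
  have hc222 : ∀ q ∈ D, fderiv ℝ c₂₂ q (0, 1) = 0 := fun q hq => by
    rw [← fderiv_eq_of_eqOn hD heq hq, ha112 q hq]
  have hder : ∀ q ∈ D, ∀ v : ℝ × ℝ,
      e * (3 * (fderiv ℝ a₁ q v * (q.1 * q.2 ^ 2)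
          + a₁ q * (v.1 * q.2 ^ 2 + q.1 * (2 * q.2 * v.2)))
        + 2 * (e - 1) * (fderiv ℝ a q v * q.2 ^ 2 + a q * (2 * q.2 * v.2)))
      - d * (3 * (fderiv ℝ c₂ q v * (q.2 * q.1 ^ 2)
          + c₂ q * (v.2 * q.1 ^ 2 + q.2 * (2 * q.1 * v.1)))
        + 2 * (d - 1) * (fderiv ℝ c q v * q.1 ^ 2 + c q * (2 * q.1 * v.1))) = 0 := by
    intro q hq v
    have haq := (differentiableAt_of_contDiffOn hD ha hq).hasFDerivAt
    have hcq := (differentiableAt_of_contDiffOn hD hc hq).hasFDerivAt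
    have ha₁q := (differentiableAt_of_contDiffOn hD hsa₁ hq).hasFDerivAt
    have hc₂q := (differentiableAt_of_contDiffOn hD hsc₂ hq).hasFDerivAt
    have x1 := hasFDerivAt_fst (𝕜 := ℝ) (p := q)
    have x2 := hasFDerivAt_snd (𝕜 := ℝ) (p := q)
    have h := apply_eq_zero_of_eqOn hD (((((ha₁q.mul (x1.mul (x2.pow 2))).const_mul 3).add
      ((haq.mul (x2.pow 2)).const_mul (2 * (e - 1)))).const_mul e).sub
      ((((hc₂q.mul (x2.mul (x1.pow 2))).const_mul 3).add
      ((hcq.mul (x1.pow 2)).const_mul (2 * (d - 1)))).const_mul d)) hE hq v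
    simp at h
    linear_combination h
  -- The terms with `c` in `hE` are `q₁²` times a function of `q₂`, so the operator `q₁∂₁ - 2` kills
  -- them and leaves an Euler equation for `a`. Symmetrically, `q₂∂₂ - 2` isolates `c` in `hG`.
  have hF : ∀ q ∈ D, 3 * (a₁₁ q * q.1 ^ 2) + (2 * e - 5) * (a₁ q * q.1) - 4 * (e - 1) * a q = 0 := by
    intro q hq
    have h := hder q hq (1, 0)
    rw [hc21 q hq, hc1 q hq] at h
    have hne : e * q.2 ^ 2 ≠ 0 := mul_ne_zero he (pow_ne_zero 2 (hDq hq).2.ne')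
    refine (mul_eq_zero.1 ?_).resolve_left hne
    linear_combination q.1 * h - 2 * hE q hq
  have hG : ∀ q ∈ D, 3 * (c₂₂ q * q.2 ^ 2) + (2 * d - 5) * (c₂ q * q.2) - 4 * (d - 1) * c q = 0 := by
    intro q hq
    have h := hder q hq (0, 1)
    rw [ha12 q hq, ha2 q hq] at h
    have hne : d * q.1 ^ 2 ≠ 0 := mul_ne_zero hd (pow_ne_zero 2 (hDq hq).1.ne')
    refine (mul_eq_zero.1 ?_).resolve_left hne
    linear_combination -q.2 * h + 2 * hE q hq
  -- Differentiating the Euler equation with `a''' = 0` gives `(2e + 1)(q₁a'' - a') = 0`; this is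
  -- where `e ≠ -1/2` enters.
  have ha1 : ∀ q ∈ D, a₁ q = a₁₁ q * q.1 := by
    intro q hq
    have haq := (differentiableAt_of_contDiffOn hD ha hq).hasFDerivAt
    have ha₁q := (differentiableAt_of_contDiffOn hD hsa₁ hq).hasFDerivAt
    have ha₁₁q := (differentiableAt_of_contDiffOn hD hsa₁₁ hq).hasFDerivAt
    have x1 := hasFDerivAt_fst (𝕜 := ℝ) (p := q)
    have h := apply_eq_zero_of_eqOn hD ((((ha₁₁q.mul (x1.pow 2)).const_mul 3).add
      ((ha₁q.mul x1).const_mul (2 * e - 5))).sub (haq.const_mul (4 * (e - 1)))) hF hq (1, 0)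
    simp [ha111 q hq] at h
    have hne : 2 * e + 1 ≠ 0 := fun h => heh (by linarith)
    refine mul_left_cancel₀ hne ?_
    simp only [ha₁₁, ha₁] at h ⊢
    linear_combination -h
  have hc2 : ∀ q ∈ D, c₂ q = c₂₂ q * q.2 := by
    intro q hq
    have hcq := (differentiableAt_of_contDiffOn hD hc hq).hasFDerivAt
    have hc₂q := (differentiableAt_of_contDiffOn hD hsc₂ hq).hasFDerivAt
    have hc₂₂q := (differentiableAt_of_contDiffOn hD hsc₂₂ hq).hasFDerivAt
    have x2 := hasFDerivAt_snd (𝕜 := ℝ) (p := q)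
    have h := apply_eq_zero_of_eqOn hD ((((hc₂₂q.mul (x2.pow 2)).const_mul 3).add
      ((hc₂q.mul x2).const_mul (2 * d - 5))).sub (hcq.const_mul (4 * (d - 1)))) hG hq (0, 1)
    simp [hc222 q hq] at h
    have hne : 2 * d + 1 ≠ 0 := fun h => hdh (by linarith)
    refine mul_left_cancel₀ hne ?_
    simp only [hc₂₂, hc₂] at h ⊢
    linear_combination -h
  intro q hq
  -- Substituting `a' = q₁a''` into the Euler equation leaves `(e - 1)(a''q₁² - 2a) = 0`.
  have ha0 : a q = a₁₁ q * q.1 ^ 2 / 2 := by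
    refine mul_left_cancel₀ (sub_ne_zero.2 he1) ?_
    linear_combination -hF q hq / 4 + (2 * e - 5) * q.1 / 4 * ha1 q hq
  have hc0 : c q = c₂₂ q * q.2 ^ 2 / 2 := by
    refine mul_left_cancel₀ (sub_ne_zero.2 hd1) ?_
    linear_combination -hG q hq / 4 + (2 * d - 5) * q.2 / 4 * hc2 q hq
  -- With `a = a''q₁²/2` and `c = a''q₂²/2`, the compatibility condition becomes `(e(e+2) - d(d+2))
  -- a'' q₁²q₂² = 0`, and the bracket factors as `(e-d)(e+d+2)`.
  have hne : (e - d) * (e + d + 2) * (q.1 ^ 2 * q.2 ^ 2) ≠ 0 :=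
    mul_ne_zero (mul_ne_zero (sub_ne_zero.2 hed) fun h => hed2 (by linarith))
      (mul_ne_zero (pow_ne_zero 2 (hDq hq).1.ne') (pow_ne_zero 2 (hDq hq).2.ne'))
  have hz : a₁₁ q = 0 := by
    refine (mul_eq_zero.1 ?_).resolve_left hne
    have h := hE q hq
    change e * (3 * (a₁ q * _) + _) - d * (3 * (c₂ q * _) + _) = 0 at h
    rw [ha1 q hq, hc2 q hq, ha0, hc0, ← heq q hq] at h
    linear_combination h
  rw [ha0, hc0, ← heq q hq, hz]
  simp

/-- An additional quadratic integral exists only for the exceptional exponents. -/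
theorem exponents_of_quadratic_integral {α β d : ℝ} (hd : d ≠ 0) (he : expo α β d ≠ 0)
    {D : Set (ℝ × ℝ)} (hD : IsOpen D) (hDq : D ⊆ quadrant) {I : Phase → ℝ}
    (hI : IsQuadraticIntegral (monoV α β d) D I) {x : Phase} (hx : x ∈ phaseOver D)
    (hind : IndepAt (ham (monoV α β d)) I x) :
    expo α β d = d ∨ expo α β d + d = -2 ∨ expo α β d = 1 ∨ expo α β d = -1 / 2 ∨ d = 1 ∨
      d = -1 / 2 := by
  by_contra! hne
  obtain ⟨hed, hed2, he1, heh, hd1, hdh⟩ := hne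
  obtain ⟨hpoly, hbr⟩ := hI
  obtain ⟨a, b, c, l, m, f, ⟨ha, hb, hc, hl, hm, hf⟩, hquad⟩ := polyInMomenta_two_iff.1 hpoly
  have hfd : ∀ y ∈ phaseOver D, fderiv ℝ I y = fderiv ℝ (quad a b c l m f) y := fun y hy =>
    fderiv_eq_of_eqOn (isOpen_phaseOver hD) hquad hy
  have hdet := fun q hq => determining_equations (q := q) (e := expo α β d) (d := d) hD
    ha hb hc hl hm hf (fun y hy => by
      have h := hbr y hy
      rw [bracket_monoV (phaseOver_mono hDq hy), hfd y hy] at h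
      exact neg_eq_zero.1 h) hq
  have hlin := linear_part_eq_zero he hd hed hD hDq hl hm (fun q hq => (hdet q hq).2.1.1)
    (fun q hq => (hdet q hq).2.1.2.1) (fun q hq => (hdet q hq).2.1.2.2)
    (fun q hq => (hdet q hq).2.2.2)
  have hac := quadratic_part_eq_zero he hd hed hed2 he1 heh hd1 hdh hD hDq ha hb hc
    (fun q hq => (hdet q hq).1.1) (fun q hq => (hdet q hq).1.2.2.2)
    (fun q hq => (hdet q hq).1.2.1) (fun q hq => (hdet q hq).1.2.2.1)
    (fun q hq => compatibility hD hDq ha hb hc hf (fun q hq => (hdet q hq).1.2.1)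
      (fun q hq => (hdet q hq).1.2.2.1) (fun q hq => (hdet q hq).2.2.1.1)
      (fun q hq => (hdet q hq).2.2.1.2) hq)
  have hx' : (x 0, x 1) ∈ D := hx
  have hz : ∀ g : ℝ × ℝ → ℝ, (∀ q ∈ D, g q = 0) → ∀ v, fderiv ℝ g (x 0, x 1) v = 0 :=
    fun g hg v => fderiv_apply_eq_zero hD hg hx' v
  obtain ⟨⟨-, hb2, hb1, -⟩, -, ⟨hf2, hf1⟩, -⟩ := hdet _ hx'
  -- Once `a, c, l, m` vanish on `D`, the gradient of `b` is zero and that of `f` is `b/2` times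
  -- that of `V`.
  have hprop : fderiv ℝ I x = (b (x 0, x 1) / 2) • fderiv ℝ (ham (monoV α β d)) x := by
    ext v
    rw [hfd x hx, quad_fderiv (differentiableAt_of_contDiffOn hD ha hx)
      (differentiableAt_of_contDiffOn hD hb hx) (differentiableAt_of_contDiffOn hD hc hx)
      (differentiableAt_of_contDiffOn hD hl hx) (differentiableAt_of_contDiffOn hD hm hx)
      (differentiableAt_of_contDiffOn hD hf hx), hz a fun q hq => (hac q hq).1,
      hz c fun q hq => (hac q hq).2, hz l fun q hq => (hlin q hq).1,
      hz m fun q hq => (hlin q hq).2, fderiv_pair b, fderiv_pair f, hf1, hf2, hb1, hb2,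
      hz a fun q hq => (hac q hq).1, hz c fun q hq => (hac q hq).2, (hac _ hx').1, (hac _ hx').2,
      (hlin _ hx').1, (hlin _ hx').2]
    simp [ham_fderiv (phaseOver_mono hDq hx)]
    ring
  rw [IndepAt, hprop] at hind
  have := (LinearIndependent.pair_iff.1 hind) (b (x 0, x 1) / 2) (-1) (by simp)
  norm_num at this

/-! ### Homogeneous quadratic integrals -/

/-- `I` is an integral, quadratic in the momenta, of weight `κ` for the flow of `ρ`. -/
structure IsHomogeneousIntegral (α β d κ : ℝ) (I : Phase → ℝ) : Prop where
  poly : PolyInMomenta 2 quadrant I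
  flow : ∀ x ∈ phaseOver quadrant, fderiv ℝ I x (flowField (expo α β d) d x) = 0
  scale : ∀ x ∈ phaseOver quadrant, fderiv ℝ I x (scaleField α β x) = κ * I x

lemma IsHomogeneousIntegral.isQuadraticIntegral {α β d κ : ℝ} {I : Phase → ℝ}
    (h : IsHomogeneousIntegral α β d κ I) {D : Set (ℝ × ℝ)} (hDq : D ⊆ quadrant) :
    IsQuadraticIntegral (monoV α β d) D I :=
  ⟨h.poly.mono hDq, fun x hx => by
    rw [bracket_monoV (hDq hx), h.flow x (hDq hx), neg_zero]⟩

/-- `X` annihilates every combination of `dH₁` and `dI`, so only the weight of `H` has to be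
checked, and the weights of `H₁` and `I` reduce this to an algebraic identity. -/
lemma solvesBiHam_of_combination {α β d κ : ℝ} (hα : α ≠ 0) {I H : Phase → ℝ}
    (hI : IsHomogeneousIntegral α β d κ I) {W : Set Phase} (hW : W ⊆ phaseOver quadrant)
    (hH : ContDiffOn ℝ ∞ H W)
    (h : ∀ x ∈ W, ∃ s t : ℝ,
      fderiv ℝ H x = s • fderiv ℝ (ham (monoV α β d)) x + t • fderiv ℝ I x ∧
      s * (-(α + β) * ham (monoV α β d) x) + t * (κ * I x) = H x) :
    SolvesBiHam α β 1 (monoV α β d) H W ∧ DependsOn H (ham (monoV α β d)) I W := by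
  refine ⟨solvesBiHam_of_fderiv hW hH ?_ ?_, ?_⟩
  · intro x hx
    obtain ⟨s, t, hd, -⟩ := h x hx
    simp [hd, ham_flow (hW hx), hI.flow x (hW hx)]
  · intro x hx
    obtain ⟨s, t, hd, hw⟩ := h x hx
    rw [one_mul, ← hw, hd, add_apply, smul_apply,
      smul_apply, ham_scale hα (hW hx), hI.scale x (hW hx), smul_eq_mul,
      smul_eq_mul]
  · intro x hx
    obtain ⟨s, t, hd, -⟩ := h x hx
    exact Submodule.mem_span_pair.2 ⟨s, t, hd.symm⟩

/-- The power `1/κ` turns weight `κ` into weight `1`. -/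
lemma solvesBiHam_rpow {α β d κ : ℝ} (hα : α ≠ 0) (hκ : κ ≠ 0) {I : Phase → ℝ}
    (hI : IsHomogeneousIntegral α β d κ I) {W : Set Phase} (hW : W ⊆ phaseOver quadrant)
    (hpos : ∀ x ∈ W, 0 < I x) :
    SolvesBiHam α β 1 (monoV α β d) (fun x => I x ^ (1 / κ)) W ∧
      DependsOn (fun x => I x ^ (1 / κ)) (ham (monoV α β d)) I W := by
  refine solvesBiHam_of_combination hα hI hW
    ((hI.poly.contDiffOn.mono hW).rpow_const_of_ne fun x hx => (hpos x hx).ne') fun x hx =>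
    ⟨0, 1 / κ * I x ^ (1 / κ - 1), ?_, ?_⟩
  · rw [((hI.poly.differentiableAt isOpen_quadrant (hW hx)).hasFDerivAt.rpow_const
      (Or.inl (hpos x hx).ne')).fderiv]
    simp
  · rw [Real.rpow_sub_one (hpos x hx).ne']
    have := (hpos x hx).ne'
    field_simp
    ring

/-- An integral of weight `0` cannot be normalised by a power of itself; the factor `H₁ ^
(-1/(α+β))` carries weight `1`. -/
lemma solvesBiHam_mul_rpow {α β d : ℝ} (hα : α ≠ 0) (hαβ : α + β ≠ 0) {I : Phase → ℝ}
    (hI : IsHomogeneousIntegral α β d 0 I) {W : Set Phase} (hW : W ⊆ phaseOver quadrant)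
    (hpos : ∀ x ∈ W, 0 < ham (monoV α β d) x) :
    SolvesBiHam α β 1 (monoV α β d)
        (fun x => I x * ham (monoV α β d) x ^ (-1 / (α + β))) W ∧
      DependsOn (fun x => I x * ham (monoV α β d) x ^ (-1 / (α + β))) (ham (monoV α β d)) I W := by
  have hham := ham_polyInMomenta α β d
  refine solvesBiHam_of_combination hα hI hW
    ((hI.poly.contDiffOn.mono hW).mul ((hham.contDiffOn.mono hW).rpow_const_of_ne
      fun x hx => (hpos x hx).ne')) fun x hx =>
    ⟨I x * (-1 / (α + β) * ham (monoV α β d) x ^ (-1 / (α + β) - 1)),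
      ham (monoV α β d) x ^ (-1 / (α + β)), ?_, ?_⟩
  · have h := (hI.poly.differentiableAt isOpen_quadrant (hW hx)).hasFDerivAt.mul
      ((hham.differentiableAt isOpen_quadrant (hW hx)).hasFDerivAt.rpow_const
      (p := -1 / (α + β)) (Or.inl (hpos x hx).ne'))
    rw [show fderiv ℝ (fun x => I x * ham (monoV α β d) x ^ (-1 / (α + β))) x = _ from h.fderiv,
      smul_smul]
  · rw [Real.rpow_sub_one (hpos x hx).ne']
    have := (hpos x hx).ne'
    field_simp
    ring

/-! ### The four listed integrals -/

/-- The exponent of `q₁` in the potential of a row. -/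
noncomputable def rowExpo (k : Fin 4) (d : ℝ) : ℝ :=
  match k with
  | 0 => d
  | 1 => -1 / 2
  | 2 => 1
  | 3 => -d - 2

/-- The weight of the integral of a row for the flow of `ρ`. -/
def rowWeight (k : Fin 4) (α : ℝ) : ℝ :=
  match k with
  | 0 => 0
  | 1 => -α
  | 2 => -(2 * α)
  | 3 => 0

lemma expo_eq_rowExpo {k : Fin 4} {α β d : ℝ} (hα : α ≠ 0) (h : rowRel k α β d) :
    expo α β d = rowExpo k d := by
  have key := expo_relation β d hα
  refine mul_left_cancel₀ hα ?_
  fin_cases k <;> simp only [rowRel, rowExpo] at h ⊢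
  · linear_combination key - (d + 1) * h
  · linear_combination key - h / 2
  · linear_combination key - 2 * h
  · linear_combination key + (d + 1) * h

lemma monoV_eq_rowV {k : Fin 4} {α β d : ℝ} (h : expo α β d = rowExpo k d) {q₁ q₂ : ℝ}
    (h₁ : 0 < q₁) : monoV α β d q₁ q₂ = rowV k d q₁ q₂ := by
  rw [monoV, h]
  fin_cases k
  · rfl
  · simp only [rowExpo, rowV]
    rw [Real.sqrt_eq_rpow, neg_div, Real.rpow_neg h₁.le]
    field_simp
  · simp [rowExpo, rowV]
  · simp only [rowExpo, rowV]
    rw [show -d - 2 = -(d + 2) by ring, Real.rpow_neg h₁.le]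
    field_simp

/-- The coefficients of the listed integrals. -/
lemma rowI_eq_quad (k : Fin 4) (d : ℝ) {x : Phase} (hx : x ∈ phaseOver quadrant) :
    rowI k d x = (match k with
      | 0 => quad (fun _ => 0) (fun _ => 0) (fun _ => 0) (fun q => q.1) (fun q => -q.2) (fun _ => 0)
      | 1 => quad (fun q => -2 * q.1) (fun q => 2 * q.2) (fun _ => 0) (fun _ => 0) (fun _ => 0)
          (mono (-1 / 2) (d + 1))
      | 2 => quad (fun _ => 1) (fun _ => 0) (fun _ => 0) (fun _ => 0) (fun _ => 0)
          (fun q => (d + 1)⁻¹ * mono 0 (d + 1) q)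
      | 3 => quad (fun q => q.1 ^ 2) (fun q => -2 * (q.1 * q.2)) (fun q => q.2 ^ 2) (fun _ => 0)
          (fun _ => 0) (fun q => -2 * mono (-(d + 1)) (d + 1) q)) x := by
  have h₁ : 0 < x 0 := hx.1
  fin_cases k <;> simp only [rowI, quad, mono]
  · ring
  · rw [Real.sqrt_eq_rpow, neg_div, Real.rpow_neg h₁.le]; ring
  · rw [Real.rpow_zero]; ring
  · rw [Real.rpow_neg h₁.le]; ring

lemma rowI_polyInMomenta (k : Fin 4) (d : ℝ) : PolyInMomenta 2 quadrant (rowI k d) := by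
  have h1 : ContDiffOn ℝ ∞ (fun q : ℝ × ℝ => q.1) quadrant := contDiff_fst.contDiffOn
  have h2 : ContDiffOn ℝ ∞ (fun q : ℝ × ℝ => q.2) quadrant := contDiff_snd.contDiffOn
  have hc : ∀ r : ℝ, ContDiffOn ℝ ∞ (fun _ : ℝ × ℝ => r) quadrant := fun _ => contDiffOn_const
  refine polyInMomenta_two_iff.2 ?_
  fin_cases k
  · exact ⟨_, _, _, _, _, _, ⟨hc 0, hc 0, hc 0, h1, h2.neg, hc 0⟩, fun x hx => rowI_eq_quad 0 d hx⟩
  · exact ⟨_, _, _, _, _, _, ⟨(hc (-2)).mul h1, (hc 2).mul h2, hc 0, hc 0, hc 0,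
      mono_contDiffOn _ _⟩, fun x hx => rowI_eq_quad 1 d hx⟩
  · exact ⟨_, _, _, _, _, _, ⟨hc 1, hc 0, hc 0, hc 0, hc 0, (hc _).mul (mono_contDiffOn _ _)⟩,
      fun x hx => rowI_eq_quad 2 d hx⟩
  · exact ⟨_, _, _, _, _, _, ⟨h1.pow 2, (hc (-2)).mul (h1.mul h2), h2.pow 2, hc 0, hc 0,
      (hc _).mul (mono_contDiffOn _ _)⟩, fun x hx => rowI_eq_quad 3 d hx⟩

lemma rowI_fderiv (k : Fin 4) (d : ℝ) (hd : k = 2 → d + 1 ≠ 0) {x : Phase}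
    (hx : x ∈ phaseOver quadrant) (v : Phase) :
    fderiv ℝ (rowI k d) x v = match k with
      | 0 => x 2 * v 0 - x 3 * v 1 + x 0 * v 2 - x 1 * v 3
      | 1 => (-2 * x 2 ^ 2 - mono (-1 / 2) (d + 1) (x 0, x 1) / (2 * x 0)) * v 0
          + (2 * (x 2 * x 3) + (d + 1) * mono (-1 / 2) (d + 1) (x 0, x 1) / x 1) * v 1
          + (2 * x 1 * x 3 - 4 * x 0 * x 2) * v 2 + 2 * x 1 * x 2 * v 3
      | 2 => mono 0 (d + 1) (x 0, x 1) / x 1 * v 1 + 2 * x 2 * v 2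
      | 3 => 2 * (x 2 * x 0 - x 3 * x 1) * (x 2 * v 0 - x 3 * v 1 + x 0 * v 2 - x 1 * v 3)
          - 2 * (d + 1) * mono (-(d + 1)) (d + 1) (x 0, x 1) * (v 1 / x 1 - v 0 / x 0) := by
  have hmono : ∀ s t, HasFDerivAt (mono s t) (fderiv ℝ (mono s t) (x 0, x 1)) (x 0, x 1) :=
    fun s t => (differentiableAt_of_contDiffOn isOpen_quadrant (mono_contDiffOn s t) hx).hasFDerivAt
  have hc : ∀ r : ℝ, DifferentiableAt ℝ (fun _ : ℝ × ℝ => r) (x 0, x 1) :=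
    fun r => differentiableAt_const r
  have x1 := hasFDerivAt_fst (𝕜 := ℝ) (p := (x 0, x 1))
  have x2 := hasFDerivAt_snd (𝕜 := ℝ) (p := (x 0, x 1))
  have h0 : x 0 ≠ 0 := hx.1.ne'
  have h1 : x 1 ≠ 0 := hx.2.ne'
  rw [fderiv_eq_of_eqOn (isOpen_phaseOver isOpen_quadrant) (fun y hy => rowI_eq_quad k d hy) hx]
  fin_cases k <;> dsimp only
  · have y2 : HasFDerivAt (fun q : ℝ × ℝ => -q.2) _ (x 0, x 1) := x2.neg
    rw [quad_fderiv (hc 0) (hc 0) (hc 0) x1.differentiableAt y2.differentiableAt (hc 0),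
      x1.fderiv, y2.fderiv]
    simp
    ring
  · rw [quad_fderiv (x1.const_mul (-2)).differentiableAt (x2.const_mul 2).differentiableAt (hc 0)
        (hc 0) (hc 0) (hmono _ _).differentiableAt, (x1.const_mul (-2)).fderiv,
      (x2.const_mul 2).fderiv, mono_fderiv hx]
    simp
    field_simp
    ring
  · have hd' := hd rfl
    rw [quad_fderiv (hc 1) (hc 0) (hc 0) (hc 0) (hc 0)
        ((hmono _ _).const_mul _).differentiableAt,
      ((hmono 0 (d + 1)).const_mul (d + 1)⁻¹).fderiv, smul_apply,
      mono_fderiv hx]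
    simp
    field_simp
  · have y12 : HasFDerivAt (fun q : ℝ × ℝ => -2 * (q.1 * q.2)) _ (x 0, x 1) :=
      (x1.mul x2).const_mul (-2)
    rw [quad_fderiv (x1.pow 2).differentiableAt y12.differentiableAt
        (x2.pow 2).differentiableAt (hc 0) (hc 0) ((hmono _ _).const_mul _).differentiableAt,
      (x1.pow 2).fderiv, (x2.pow 2).fderiv, y12.fderiv,
      ((hmono (-(d + 1)) (d + 1)).const_mul (-2)).fderiv]
    simp only [smul_apply, mono_fderiv hx]
    simp
    field_simp
    ring

/-- The third listed integral has the denominator `d + 1`; with `e = 1` and `d = -1` the homogeneity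
relation would read `2α = 0`. -/
lemma add_one_ne_zero_of_expo {k : Fin 4} {α β d : ℝ} (hα : α ≠ 0)
    (h : expo α β d = rowExpo k d) : k = 2 → d + 1 ≠ 0 := by
  rintro rfl h0
  have hrel := expo_relation β d hα
  rw [h, h0] at hrel
  simp [rowExpo, hα] at hrel

/-- Assuming the exponent rather than the relation between the parameters also covers `d = -1`,
where the relation may fail. Conservation uses only the exponents; the parameters enter through the
weight. -/
lemma rowI_isHomogeneousIntegral {k : Fin 4} {α β d : ℝ} (hα : α ≠ 0)
    (h : expo α β d = rowExpo k d) :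
    IsHomogeneousIntegral α β d (rowWeight k α) (rowI k d) := by
  have hrel := expo_relation β d hα
  have hd := add_one_ne_zero_of_expo hα h
  -- The monomials of `V` and of the integral differ by integer powers of `q₁` and `q₂`; both are
  -- reduced to a common monomial before clearing denominators.
  have mono_succ : ∀ s t : ℝ, ∀ q ∈ quadrant, mono s (t + 1) q = mono s t q * q.2 :=
    fun s t q hq => by rw [mono, mono, Real.rpow_add_one hq.2.ne']; ring
  have succ_mono : ∀ s t : ℝ, ∀ q ∈ quadrant, mono (s + 1) t q = mono s t q * q.1 :=
    fun s t q hq => by rw [mono, mono, Real.rpow_add_one hq.1.ne']; ring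
  refine ⟨rowI_polyInMomenta k d, fun x hx => ?_, fun x hx => ?_⟩
  · rw [rowI_fderiv k d hd hx, h]
    have h0 : x 0 ≠ 0 := hx.1.ne'
    have h1 : x 1 ≠ 0 := hx.2.ne'
    fin_cases k <;> simp [flowField, rowExpo]
    · field_simp; ring
    · rw [mono_succ _ _ _ hx]; field_simp; ring
    · rw [mono_succ _ _ _ hx, ← zero_add (1 : ℝ), succ_mono _ _ _ hx]; field_simp; ring
    · rw [mono_succ _ _ _ hx, show -1 + -d = (-d - 2) + 1 by ring, succ_mono _ _ _ hx]
      field_simp; ring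
  · rw [rowI_fderiv k d hd hx, rowI_eq_quad k d hx]
    rw [h] at hrel
    have h0 : x 0 ≠ 0 := hx.1.ne'
    have h1 : x 1 ≠ 0 := hx.2.ne'
    fin_cases k <;> simp only [rowExpo] at hrel <;> dsimp only [quad]
    · simp [scaleField, rowWeight]
      ring
    · generalize mono (-1 / 2) (d + 1) (x 0, x 1) = u
      simp [scaleField, rowWeight]
      field_simp
      linear_combination 2 * u * hrel
    · have hd' := hd rfl
      generalize mono 0 (d + 1) (x 0, x 1) = u
      simp [scaleField, rowWeight]
      field_simp
      linear_combination u * hrel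
    · generalize mono (-(d + 1)) (d + 1) (x 0, x 1) = u
      simp [scaleField, rowWeight]
      field_simp
      linear_combination (-2) * u * hrel

/-- The listed integral is independent of the Hamiltonian at generic points. -/
lemma rowI_minor_ne_zero (k : Fin 4) {d : ℝ} (hd : k = 2 → d + 1 ≠ 0) {x : Phase}
    (hx : x ∈ phaseOver quadrant) (h0 : x 0 * x 2 ≠ 0) (h1 : x 0 * x 2 ≠ x 1 * x 3)
    (h2 : x 0 * x 2 ≠ -(x 1 * x 3)) :
    x 3 * partialD (rowI k d) 3 x - x 2 * partialD (rowI k d) 2 x ≠ 0 := by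
  have hx2 : x 2 ≠ 0 := right_ne_zero_of_mul h0
  have h1' := sub_ne_zero.2 h1
  have h2' : x 0 * x 2 + x 1 * x 3 ≠ 0 := fun h => h2 (by linarith)
  rw [partialD, partialD, rowI_fderiv k d hd hx, rowI_fderiv k d hd hx]
  intro h
  -- Up to nonzero constants the minors are `q₁p₁ + q₂p₂`, `q₁p₁²`, `p₁²` and `(q₁p₁ - q₂p₂)(q₁p₁ +
  -- q₂p₂)`.
  fin_cases k <;> simp at h
  · exact h2' (by linear_combination -h)
  · exact mul_ne_zero h0 hx2 (by linear_combination h / 4)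
  · exact hx2 h
  · exact mul_ne_zero h1' h2' (by linear_combination -h / 2)

/-! ### Continuity arguments along shifts of the first momentum -/

/-- Carries an identity proved off a degenerate locus over to the locus itself. -/
lemma eq_zero_of_eventually_shift {F : Phase → ℝ} {x : Phase} (hF : ContinuousAt F x)
    (h : ∀ᶠ t in nhdsWithin (0 : ℝ) {0}ᶜ, F (shift x t) = 0) : F x = 0 :=
  tendsto_nhds_unique (hF.tendsto.comp (tendsto_shift x))
    (tendsto_const_nhds.congr' (h.mono fun _ ht => ht.symm))

lemma eventually_shift_mem {W : Set Phase} (hW : IsOpen W) {x : Phase} (hx : x ∈ W) :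
    ∀ᶠ t in nhdsWithin (0 : ℝ) {0}ᶜ, shift x t ∈ W :=
  (tendsto_shift x).eventually (hW.mem_nhds hx)

lemma continuousOn_flowField (e d : ℝ) : ContinuousOn (flowField e d) (phaseOver quadrant) := by
  have hm : ContinuousOn (fun x : Phase => mono e d (x 0, x 1)) (phaseOver quadrant) :=
    (contDiffOn_comp_base (mono_contDiffOn e d)).continuousOn
  have hi : ∀ i : Fin 4, ContinuousOn (fun x : Phase => x i) (phaseOver quadrant) :=
    fun i => (continuous_apply i).continuousOn
  refine continuousOn_pi.2 fun i => ?_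
  fin_cases i
  · exact continuousOn_const.mul (hi 3)
  · exact continuousOn_const.mul (hi 2)
  · exact ((continuousOn_const.mul hm).div (hi 0) fun x hx => hx.1.ne').neg
  · exact ((continuousOn_const.mul hm).div (hi 1) fun x hx => hx.2.ne').neg

/-- A solution of the bi-Hamiltonian equations is a first integral. -/
lemma flow_eq_zero_of_solvesBiHam {α β κ d : ℝ} (hα : α ≠ 0) {W : Set Phase} (hW : IsOpen W)
    (hWq : W ⊆ phaseOver quadrant) {H : Phase → ℝ} (h : SolvesBiHam α β κ (monoV α β d) H W)
    {x : Phase} (hx : x ∈ W) : fderiv ℝ H x (flowField (expo α β d) d x) = 0 := by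
  have hcont : ContinuousAt (fun y => fderiv ℝ H y (flowField (expo α β d) d y)) x :=
    ((h.1.continuousOn_fderiv_of_isOpen hW (by simp)).clm_apply
      ((continuousOn_flowField _ _).mono hWq)).continuousAt (hW.mem_nhds hx)
  refine eq_zero_of_eventually_shift
    (F := fun y => fderiv ℝ H y (flowField (expo α β d) d y)) hcont ?_
  filter_upwards [eventually_shift_mem hW hx,
    eventually_shift_ne x (mul_ne_zero hα (hWq hx).1.ne') (β * x 1 * x 3)] with t ht hne
  have hs := h.2 _ ht
  rw [secondBivector_mulVec (hWq ht), hamField_monoV (hWq ht)] at hs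
  have e0 := congrFun hs 0
  have e1 := congrFun hs 1
  simp only [Pi.smul_apply, Pi.sub_apply, smul_eq_mul] at e0 e1
  have f0 : flowField (expo α β d) d (shift x t) 0 = 2 * shift x t 3 := rfl
  have f1 : flowField (expo α β d) d (shift x t) 1 = 2 * shift x t 2 := rfl
  have s0 : scaleField α β (shift x t) 0 = α * shift x t 0 := rfl
  have s1 : scaleField α β (shift x t) 1 = β * shift x t 1 := rfl
  rw [f0, s0] at e0
  rw [f1, s1] at e1
  -- The first two components of `X` are `2p₂` and `2p₁`, so `p₁` times the first equation minus
  -- `p₂` times the second eliminates `X` and leaves `X(H)(αq₁p₁ - βq₂p₂) = 0`.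
  refine (mul_eq_zero.1 ?_).resolve_right (sub_ne_zero.2 hne)
  rw [shift_zero, shift_three] at e0
  rw [shift_one] at e1
  linear_combination shift x t 2 * e0 - x 3 * e1

/-- In the first family a solution depending on the two integrals alone vanishes. -/
theorem solution_eq_zero_of_dependsOn {α β d : ℝ} (hα : α ≠ 0) (hαβ : α = -β) {W : Set Phase}
    {H : Phase → ℝ} (hW : IsOpen W) (hWq : W ⊆ phaseOver quadrant)
    (hs : SolvesBiHam α β 1 (monoV α β d) H W)
    (hdep : DependsOn H (ham (monoV α β d)) (rowI 0 d) W) {x : Phase} (hx : x ∈ W) : H x = 0 := by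
  have hI := rowI_isHomogeneousIntegral (k := 0) (β := β) hα
    (expo_eq_rowExpo (k := 0) (d := d) hα hαβ)
  refine eq_zero_of_eventually_shift (hs.1.continuousOn.continuousAt (hW.mem_nhds hx)) ?_
  filter_upwards [eventually_shift_mem hW hx, eventually_shift_ne x one_ne_zero 0] with t ht hne
  have hy := hWq ht
  -- Both integrals have weight `0` because `α + β = 0`, so (*) reduces to `H X = 0`; the second
  -- component `2p₁` of `X` is nonzero at the shifted point.
  have hscale : fderiv ℝ H (shift x t) (scaleField α β (shift x t)) = 0 := by
    obtain ⟨r, s, h⟩ := Submodule.mem_span_pair.1 (hdep _ ht)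
    rw [← h, add_apply, smul_apply, smul_apply, ham_scale hα hy, hI.scale _ hy, hαβ]
    simp [rowWeight]
  have e := hs.2 _ ht
  rw [secondBivector_mulVec hy, hamField_monoV hy, hscale,
    flow_eq_zero_of_solvesBiHam hα hW hWq hs ht] at e
  have e1 : 1 * H (shift x t) * (2 * shift x t 2) = 0 := by simpa [flowField] using congrFun e 1
  rw [one_mul] at e1 hne
  exact (mul_eq_zero.1 e1).resolve_right (mul_ne_zero two_ne_zero hne)

/-! ### Exchange of the two pairs of coordinates -/

/-- The permutation of the pairs `(q₁, p₁)` and `(q₂, p₂)`. -/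
noncomputable def exchange : Phase →L[ℝ] Phase :=
  ContinuousLinearMap.pi fun i => ContinuousLinearMap.proj ((![1, 0, 3, 2] : Fin 4 → Fin 4) i)

@[simp] lemma exchange_apply (x : Phase) : exchange x = ![x 1, x 0, x 3, x 2] := by
  ext i; fin_cases i <;> rfl

lemma exchange_mem {x : Phase} (hx : x ∈ phaseOver quadrant) : exchange x ∈ phaseOver quadrant := by
  simpa [phaseOver, quadrant, and_comm] using hx

lemma expo_expo {α β : ℝ} (d : ℝ) (hα : α ≠ 0) (hβ : β ≠ 0) : expo β α (expo α β d) = d := by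
  simp only [expo]; field_simp; ring

lemma mono_exchange (e d q₁ q₂ : ℝ) : mono e d (q₁, q₂) = mono d e (q₂, q₁) :=
  mul_comm _ _

lemma exchange_flowField (e d : ℝ) (x : Phase) :
    exchange (flowField e d x) = flowField d e (exchange x) := by
  rw [exchange_apply, exchange_apply]
  simp [flowField, mono_exchange d e (x 1)]

lemma exchange_scaleField (α β : ℝ) (x : Phase) :
    exchange (scaleField α β x) = scaleField β α (exchange x) := by
  rw [exchange_apply, exchange_apply]
  simp [scaleField]

lemma fderiv_comp_exchange {F : Phase → ℝ} {x : Phase} (hF : DifferentiableAt ℝ F (exchange x))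
    (v : Phase) : fderiv ℝ (F ∘ exchange) x v = fderiv ℝ F (exchange x) (exchange v) := by
  rw [(hF.hasFDerivAt.comp x exchange.hasFDerivAt).fderiv]; rfl

lemma PolyInMomenta.comp_exchange {F : Phase → ℝ} (h : PolyInMomenta 2 quadrant F) :
    PolyInMomenta 2 quadrant (F ∘ exchange) := by
  obtain ⟨a, b, c, l, m, f, ⟨ha, hb, hc, hl, hm, hf⟩, hF⟩ := polyInMomenta_two_iff.1 h
  have hs : ∀ g : ℝ × ℝ → ℝ, ContDiffOn ℝ ∞ g quadrant →
      ContDiffOn ℝ ∞ (fun q => g (q.2, q.1)) quadrant := fun g hg =>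
    hg.comp (f := fun q : ℝ × ℝ => (q.2, q.1)) (contDiff_snd.prodMk contDiff_fst).contDiffOn
      fun q hq => ⟨hq.2, hq.1⟩
  refine polyInMomenta_two_iff.2 ⟨_, _, _, _, _, _,
    ⟨hs c hc, hs b hb, hs a ha, hs m hm, hs l hl, hs f hf⟩, fun x hx => ?_⟩
  rw [Function.comp_apply, hF _ (exchange_mem hx), exchange_apply]
  simp [quad]
  ring

lemma IsHomogeneousIntegral.comp_exchange {α β d κ : ℝ} (hα : α ≠ 0) (hβ : β ≠ 0) {I : Phase → ℝ}
    (h : IsHomogeneousIntegral β α (expo α β d) κ I) :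
    IsHomogeneousIntegral α β d κ (I ∘ exchange) := by
  have hd : ∀ x ∈ phaseOver quadrant, DifferentiableAt ℝ I (exchange x) := fun x hx =>
    h.poly.differentiableAt isOpen_quadrant (exchange_mem hx)
  refine ⟨h.poly.comp_exchange, fun x hx => ?_, fun x hx => ?_⟩
  · have := h.flow _ (exchange_mem hx)
    rw [expo_expo d hα hβ] at this
    rw [fderiv_comp_exchange (hd x hx), exchange_flowField, this]
  · rw [fderiv_comp_exchange (hd x hx), exchange_scaleField, h.scale _ (exchange_mem hx),
      Function.comp_apply]

lemma minor_comp_exchange {F : Phase → ℝ} {x : Phase} (hF : DifferentiableAt ℝ F (exchange x)) :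
    x 3 * partialD (F ∘ exchange) 3 x - x 2 * partialD (F ∘ exchange) 2 x =
      -(exchange x 3 * partialD F 3 (exchange x) - exchange x 2 * partialD F 2 (exchange x)) := by
  have h2 : exchange (Pi.single 2 1) = Pi.single 3 1 := by
    rw [exchange_apply]; ext i; fin_cases i <;> simp
  have h3 : exchange (Pi.single 3 1) = Pi.single 2 1 := by
    rw [exchange_apply]; ext i; fin_cases i <;> simp
  simp only [partialD, fderiv_comp_exchange hF, h2, h3]
  have e2 : exchange x 2 = x 3 := rfl
  have e3 : exchange x 3 = x 2 := rfl
  rw [e2, e3]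
  ring

/-! ### Realization of the families -/

lemma rowI_exists_minor_ne_zero (k : Fin 4) {d : ℝ} (hd : k = 2 → d + 1 ≠ 0) {q : ℝ × ℝ}
    (hq : q ∈ quadrant) : ∃ s t : ℝ,
      (![q.1, q.2, s, t] : Phase) 3 * partialD (rowI k d) 3 ![q.1, q.2, s, t]
        - (![q.1, q.2, s, t] : Phase) 2 * partialD (rowI k d) 2 ![q.1, q.2, s, t] ≠ 0 := by
  have h1 : q.1 ≠ 0 := hq.1.ne'
  exact ⟨1, 0, rowI_minor_ne_zero k hd (by simpa [phaseOver] using hq) (by simpa using h1)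
    (by simpa using h1) (by simpa using h1)⟩

lemma rowI_exists_pos {k : Fin 4} (hk : k = 1 ∨ k = 2) (d : ℝ) {q : ℝ × ℝ} (hq : q ∈ quadrant) :
    ∃ s t : ℝ, 0 < rowI k d ![q.1, q.2, s, t] := by
  have h1 := hq.1
  have h2 := hq.2
  rcases hk with rfl | rfl
  · refine ⟨0, 0, ?_⟩
    simp [rowI]
    positivity
  -- For `d < -1` the potential term is negative, so `p₁` is taken large enough for `p₁²` to
  -- dominate it.
  · refine ⟨1 + |q.2 ^ (d + 1) / (d + 1)|, 0, ?_⟩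
    simp only [rowI]
    simp
    have := neg_abs_le (q.2 ^ (d + 1) / (d + 1))
    nlinarith [abs_nonneg (q.2 ^ (d + 1) / (d + 1))]

/-- The second and fourth equivalent conditions. -/
def Realized (α β d : ℝ) (D : Set (ℝ × ℝ)) : Prop :=
  (∃ (I₂ H₂ : Phase → ℝ) (W : Set Phase),
    IsQuadraticIntegral (monoV α β d) D I₂ ∧
    (∃ x ∈ phaseOver D, IndepAt (ham (monoV α β d)) I₂ x) ∧
    IsOpen W ∧ W.Nonempty ∧ W ⊆ phaseOver D ∧
    SolvesBiHam α β 1 (monoV α β d) H₂ W ∧ DependsOn H₂ (ham (monoV α β d)) I₂ W) ∧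
  ∃ (κ : ℝ) (H₂ : Phase → ℝ), PolyInMomenta 2 D H₂ ∧
    SolvesBiHam α β κ (monoV α β d) H₂ (phaseOver D) ∧
    ∃ x ∈ phaseOver D, IndepAt (ham (monoV α β d)) H₂ x

/-- One homogeneous integral serves both conditions: `I` itself solves (*) with its own weight as
`κ`, and `H` solves it with `κ = 1`. The hypotheses are imposed in the fibre over every
configuration so that any `D` can be treated. -/
lemma realized_of_integral {α β d κ : ℝ} {I H : Phase → ℝ} {U : Set Phase}
    (hI : IsHomogeneousIntegral α β d κ I)
    (hminor : ∀ q ∈ quadrant, ∃ s t : ℝ,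
      (![q.1, q.2, s, t] : Phase) 3 * partialD I 3 ![q.1, q.2, s, t]
        - (![q.1, q.2, s, t] : Phase) 2 * partialD I 2 ![q.1, q.2, s, t] ≠ 0)
    (hU : IsOpen U) (hUne : ∀ q ∈ quadrant, ∃ s t : ℝ, ![q.1, q.2, s, t] ∈ U)
    (hH : SolvesBiHam α β 1 (monoV α β d) H U) (hdep : DependsOn H (ham (monoV α β d)) I U)
    {D : Set (ℝ × ℝ)} (hD : IsOpen D) (hne : D.Nonempty) (hDq : D ⊆ quadrant) :
    Realized α β d D := by
  obtain ⟨q, hq⟩ := hne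
  have hmem : ∀ s t : ℝ, ![q.1, q.2, s, t] ∈ phaseOver D := fun s t => by
    simpa [phaseOver] using hq
  have hind : ∃ x ∈ phaseOver D, IndepAt (ham (monoV α β d)) I x := by
    obtain ⟨s, t, h⟩ := hminor q (hDq hq)
    exact ⟨_, hmem s t, indepAt_of_minor (phaseOver_mono hDq (hmem s t)) h⟩
  refine ⟨⟨I, H, U ∩ phaseOver D, hI.isQuadraticIntegral hDq, hind,
    hU.inter (isOpen_phaseOver hD), ?_, Set.inter_subset_right,
    ⟨hH.1.mono Set.inter_subset_left, fun x hx => hH.2 x hx.1⟩, fun x hx => hdep x hx.1⟩,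
    κ, I, hI.poly.mono hDq, ?_, hind⟩
  · obtain ⟨s, t, h⟩ := hUne q (hDq hq)
    exact ⟨_, h, hmem s t⟩
  · exact solvesBiHam_of_fderiv (phaseOver_mono hDq)
      (hI.poly.contDiffOn.mono (phaseOver_mono hDq)) (fun x hx => hI.flow x (hDq hx))
      fun x hx => hI.scale x (hDq hx)

lemma mem_rowDom_iff {k : Fin 4} {α β d : ℝ} (h : expo α β d = rowExpo k d) {x : Phase} :
    x ∈ rowDom k d ↔
      x ∈ phaseOver quadrant ∧ rowPos k (ham (monoV α β d) x) (rowI k d x) := by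
  refine and_congr_right fun hx => ?_
  rw [ham, ham, monoV_eq_rowV h hx.1]

lemma rowDom_subset (k : Fin 4) (d : ℝ) : rowDom k d ⊆ phaseOver quadrant := fun _ hx => hx.1

lemma isOpen_rowDom {k : Fin 4} {α β d : ℝ} (h : expo α β d = rowExpo k d) :
    IsOpen (rowDom k d) := by
  have hQ := isOpen_phaseOver isOpen_quadrant
  have heq : rowDom k d = phaseOver quadrant ∩
      {x | rowPos k (ham (monoV α β d) x) (rowI k d x)} := by
    ext x; exact mem_rowDom_iff h
  have hI := (rowI_polyInMomenta k d).contDiffOn.continuousOn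
  have hH := (ham_polyInMomenta α β d).contDiffOn.continuousOn
  rw [heq]
  fin_cases k
  · simpa [rowPos] using hQ
  · exact hI.isOpen_inter_preimage hQ isOpen_Ioi
  · exact hI.isOpen_inter_preimage hQ isOpen_Ioi
  · exact hH.isOpen_inter_preimage hQ isOpen_Ioi

lemma exists_mem_rowDom {k : Fin 4} {α β d : ℝ} (h : expo α β d = rowExpo k d) {q : ℝ × ℝ}
    (hq : q ∈ quadrant) : ∃ s t : ℝ, ![q.1, q.2, s, t] ∈ rowDom k d := by
  simp only [mem_rowDom_iff h]
  have hmem : ∀ s t : ℝ, ![q.1, q.2, s, t] ∈ phaseOver quadrant := fun s t => by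
    simpa [phaseOver] using hq
  fin_cases k
  · exact ⟨0, 0, hmem 0 0, trivial⟩
  · obtain ⟨s, t, hst⟩ := rowI_exists_pos (Or.inl rfl) d hq
    exact ⟨s, t, hmem s t, hst⟩
  · obtain ⟨s, t, hst⟩ := rowI_exists_pos (Or.inr rfl) d hq
    exact ⟨s, t, hmem s t, hst⟩
  · refine ⟨0, 0, hmem 0 0, ?_⟩
    have := mono_pos (s := expo α β d) (t := d) hq
    simpa [rowPos, ham, monoV_eq] using this

lemma rowH_solves {k : Fin 4} {α β d : ℝ} (hα : α ≠ 0) (h : expo α β d = rowExpo k d)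
    (hk : k = 3 → α = β) :
    SolvesBiHam α β 1 (monoV α β d)
        (fun x => rowH k α (ham (monoV α β d) x) (rowI k d x)) (rowDom k d) ∧
      DependsOn (fun x => rowH k α (ham (monoV α β d) x) (rowI k d x)) (ham (monoV α β d))
        (rowI k d) (rowDom k d) := by
  have hI := rowI_isHomogeneousIntegral (β := β) hα h
  have hW := rowDom_subset k d
  have hpos := fun x (hx : x ∈ rowDom k d) => ((mem_rowDom_iff h).1 hx).2
  fin_cases k
  · refine solvesBiHam_of_combination hα hI hW contDiffOn_const fun x _ => ⟨0, 0, ?_, ?_⟩ <;>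
      simp [rowH]
  · have e : -1 / α = 1 / rowWeight 1 α := by simp [rowWeight, neg_div, div_neg]
    simp only [rowH, e]
    exact solvesBiHam_rpow hα (neg_ne_zero.2 hα) hI hW hpos
  · have e : -1 / (2 * α) = 1 / rowWeight 2 α := by
      simp only [rowWeight, neg_div, div_neg]
    simp only [rowH, e]
    exact solvesBiHam_rpow hα (neg_ne_zero.2 (mul_ne_zero two_ne_zero hα)) hI hW hpos
  · have hαβ := hk rfl
    have e : -1 / (2 * α) = -1 / (α + β) := by rw [← hαβ, two_mul]
    simp only [rowH, e]
    exact solvesBiHam_mul_rpow hα (by rw [← hαβ, ← two_mul]; exact mul_ne_zero two_ne_zero hα)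
      hI hW hpos

lemma realized_of_row {k : Fin 4} {α β d : ℝ} (hα : α ≠ 0) (h : expo α β d = rowExpo k d)
    (hk : k = 3 → α = β) {D : Set (ℝ × ℝ)} (hD : IsOpen D) (hne : D.Nonempty)
    (hDq : D ⊆ quadrant) : Realized α β d D :=
  realized_of_integral (rowI_isHomogeneousIntegral hα h)
    (fun _ hq => rowI_exists_minor_ne_zero k (add_one_ne_zero_of_expo hα h) hq) (isOpen_rowDom h)
    (fun _ hq => exists_mem_rowDom h hq) (rowH_solves hα h hk).1 (rowH_solves hα h hk).2 hD hne hDq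

/-- Only the integral is carried through the exchange. In these two rows its weight is nonzero, so
the normalising power gives `H₂` directly. -/
lemma realized_of_exchanged_row {k : Fin 4} {α β d : ℝ} (hα : α ≠ 0) (hβ : β ≠ 0)
    (hk : k = 1 ∨ k = 2) (hrel : rowRel k β α (expo α β d)) {D : Set (ℝ × ℝ)} (hD : IsOpen D)
    (hne : D.Nonempty) (hDq : D ⊆ quadrant) : Realized α β d D := by
  have h := expo_eq_rowExpo hβ hrel
  have hrow := rowI_isHomogeneousIntegral hβ h
  have hI := hrow.comp_exchange hα hβ
  have hw : rowWeight k β ≠ 0 := by rcases hk with rfl | rfl <;> simp [rowWeight, hβ]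
  have hmem : ∀ q ∈ quadrant, ∀ s t : ℝ, ![q.1, q.2, s, t] ∈ phaseOver quadrant :=
    fun q hq s t => by simpa [phaseOver] using hq
  have hex : ∀ (q : ℝ × ℝ) (s t : ℝ), exchange ![q.1, q.2, s, t] = ![q.2, q.1, t, s] :=
    fun q s t => by rw [exchange_apply]; rfl
  have hsol := solvesBiHam_rpow hα hw hI
    (W := phaseOver quadrant ∩ (rowI k (expo α β d) ∘ exchange) ⁻¹' Set.Ioi 0)
    Set.inter_subset_left fun x hx => hx.2
  refine realized_of_integral hI (fun q hq => ?_)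
    (hI.poly.contDiffOn.continuousOn.isOpen_inter_preimage (isOpen_phaseOver isOpen_quadrant)
      isOpen_Ioi) (fun q hq => ?_) hsol.1 hsol.2 hD hne hDq
  · obtain ⟨t, s, hst⟩ := rowI_exists_minor_ne_zero k (add_one_ne_zero_of_expo hβ h)
      (q := (q.2, q.1)) ⟨hq.2, hq.1⟩
    refine ⟨s, t, ?_⟩
    rw [minor_comp_exchange (hrow.poly.differentiableAt isOpen_quadrant
      (exchange_mem (hmem q hq s t))), hex]
    exact neg_ne_zero.2 hst
  · obtain ⟨t, s, hst⟩ := rowI_exists_pos hk (expo α β d) (q := (q.2, q.1)) ⟨hq.2, hq.1⟩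
    refine ⟨s, t, hmem q hq s t, ?_⟩
    rw [Set.mem_preimage, Function.comp_apply, hex]
    exact hst

lemma realized_of_inTable {α β d : ℝ} (hα : α ≠ 0) (hβ : β ≠ 0) (h : InTable α β d)
    {D : Set (ℝ × ℝ)} (hD : IsOpen D) (hne : D.Nonempty) (hDq : D ⊆ quadrant) :
    Realized α β d D := by
  have hrel := expo_relation β d hα
  by_cases hd : d = -1
  -- For `d = -1` the relation forces `e = -1 = d`, whatever `α` and `β` are. The first row is used
  -- because its `H₂ = 0` needs no relation between them, unlike the fourth.
  · refine realized_of_row (k := 0) hα ?_ (fun h => absurd h (by decide)) hD hne hDq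
    subst hd
    refine mul_left_cancel₀ hα ?_
    simp only [rowExpo]
    linear_combination hrel
  · obtain ⟨k, ⟨-, hk⟩ | ⟨-, hk⟩⟩ := h
    · have hk := hk hd
      exact realized_of_row hα (expo_eq_rowExpo hα hk) (by rintro rfl; exact hk) hD hne hDq
    · have he : expo α β d ≠ -1 := by
        intro he
        rw [he] at hrel
        have : β * (d + 1) = 0 := by linear_combination hrel
        exact (mul_ne_zero hβ fun h => hd (by linarith)) this
      have hk := hk he
      -- The relations of rows `0` and `3` are symmetric in `α` and `β`, so these rows need no
      -- exchange.
      fin_cases k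
      · have hk : β = -α := hk
        exact realized_of_row (k := 0) hα (expo_eq_rowExpo hα (show α = -β by rw [hk, neg_neg]))
          (fun h => absurd h (by decide)) hD hne hDq
      · exact realized_of_exchanged_row hα hβ (Or.inl rfl) hk hD hne hDq
      · exact realized_of_exchanged_row hα hβ (Or.inr rfl) hk hD hne hDq
      · have hk : α = β := Eq.symm hk
        exact realized_of_row (k := 3) hα (expo_eq_rowExpo hα (show rowRel 3 α β d from hk))
          (fun _ => hk) hD hne hDq

/-! ### The exceptional exponents belong to the table -/

lemma isRow_of_expo {k : Fin 4} {α β d : ℝ} (h : expo α β d = rowExpo k d)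
    (hrel : d ≠ -1 → rowRel k α β d) : IsRow (monoV α β d) k α β d :=
  ⟨fun _ _ h₁ _ => monoV_eq_rowV h h₁, hrel⟩

lemma isRow_exchange_of_expo {k : Fin 4} {α β d : ℝ} (hα : α ≠ 0) (hβ : β ≠ 0)
    (hrel : rowRel k β α (expo α β d)) :
    IsRow (fun q₁ q₂ => monoV α β d q₂ q₁) k β α (expo α β d) := by
  refine ⟨fun q₁ q₂ h₁ _ => ?_, fun _ => hrel⟩
  rw [← monoV_eq_rowV (expo_eq_rowExpo hβ hrel) h₁, monoV_eq β, expo_expo d hα hβ,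
    mono_exchange]
  rfl

/-- Each exceptional value is substituted into `α(e+1) + β(d+1) = 0`. For `e = d` and `e + d = -2`
this gives `(α+β)(d+1) = 0` and `(β-α)(d+1) = 0`, hence a relation between `α` and `β` only when `d
≠ -1`. -/
lemma inTable_of_exponents {α β d : ℝ} (hα : α ≠ 0) (hβ : β ≠ 0)
    (h : expo α β d = d ∨ expo α β d + d = -2 ∨ expo α β d = 1 ∨ expo α β d = -1 / 2 ∨ d = 1 ∨
      d = -1 / 2) : InTable α β d := by
  have hrel := expo_relation β d hα
  rcases h with h | h | h | h | h | h
  · refine ⟨0, Or.inl (isRow_of_expo h fun hd => ?_)⟩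
    have hd' : d + 1 ≠ 0 := fun h => hd (by linarith)
    rw [h] at hrel
    exact mul_right_cancel₀ hd' (by linear_combination hrel)
  · refine ⟨3, Or.inl (isRow_of_expo (show _ = -d - 2 by linarith) fun hd => ?_)⟩
    have hd' : d + 1 ≠ 0 := fun h => hd (by linarith)
    rw [show expo α β d = -d - 2 by linarith] at hrel
    exact mul_right_cancel₀ hd' (by linear_combination -hrel)
  · refine ⟨2, Or.inl (isRow_of_expo h fun _ => ?_)⟩
    rw [h] at hrel
    exact show α = -(β * (d + 1) / 2) by linear_combination hrel / 2
  · refine ⟨1, Or.inl (isRow_of_expo h fun _ => ?_)⟩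
    rw [h] at hrel
    exact show α = -2 * β * (d + 1) by linear_combination 2 * hrel
  · refine ⟨2, Or.inr (isRow_exchange_of_expo hα hβ ?_)⟩
    rw [h] at hrel ⊢
    exact show β = -(α * (expo α β 1 + 1) / 2) by linear_combination hrel / 2
  · refine ⟨1, Or.inr (isRow_exchange_of_expo hα hβ ?_)⟩
    rw [h] at hrel ⊢
    exact show β = -2 * α * (expo α β (-1 / 2) + 1) by linear_combination 2 * hrel

/-- At most three values of `p₁` are excluded on each line parallel to the `p₁`-axis, so arbitrarily
small shifts of `p₁` reach points of independence. -/
lemma phaseOver_subset_closure_indepAt {k : Fin 4} {α β d : ℝ} (hd : k = 2 → d + 1 ≠ 0) :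
    phaseOver quadrant ⊆ closure {x | x ∈ phaseOver quadrant ∧
      IndepAt (ham (monoV α β d)) (rowI k d) x} := by
  intro x hx
  have h0 : x 0 ≠ 0 := hx.1.ne'
  refine mem_closure_of_tendsto (tendsto_shift x) ?_
  filter_upwards [eventually_shift_mem (isOpen_phaseOver isOpen_quadrant) hx,
    eventually_shift_ne x h0 0, eventually_shift_ne x h0 (x 1 * x 3),
    eventually_shift_ne x h0 (-(x 1 * x 3))] with t ht h1 h2 h3
  exact ⟨ht, indepAt_of_minor ht (rowI_minor_ne_zero k hd ht (by simpa using h1)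
    (by simpa using h2) (by simpa using h3))⟩

end BiHam

theorem mainTheorem1 (α β d : ℝ) (hα : α ≠ 0) (hβ : β ≠ 0) :
    -- There are only four families of potentials depending on both variables.
    (d ≠ 0 → BiHam.expo α β d ≠ 0 →
      ∀ D : Set (ℝ × ℝ), IsOpen D → D.Nonempty → D ⊆ BiHam.quadrant →
        List.TFAE [
          BiHam.InTable α β d,
          -- a solution for `κ₂ = 1` related to an additional quadratic integral `I₂`
          ∃ (I₂ H₂ : BiHam.Phase → ℝ) (W : Set BiHam.Phase),
            BiHam.IsQuadraticIntegral (BiHam.monoV α β d) D I₂ ∧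
            (∃ x ∈ BiHam.phaseOver D, BiHam.IndepAt (BiHam.ham (BiHam.monoV α β d)) I₂ x) ∧
            IsOpen W ∧ W.Nonempty ∧ W ⊆ BiHam.phaseOver D ∧
            BiHam.SolvesBiHam α β 1 (BiHam.monoV α β d) H₂ W ∧
            BiHam.DependsOn H₂ (BiHam.ham (BiHam.monoV α β d)) I₂ W,
          -- an additional quadratic integral
          ∃ I₂ : BiHam.Phase → ℝ,
            BiHam.IsQuadraticIntegral (BiHam.monoV α β d) D I₂ ∧
            ∃ x ∈ BiHam.phaseOver D, BiHam.IndepAt (BiHam.ham (BiHam.monoV α β d)) I₂ x,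
          -- a solution, for some `κ₂`, which is itself quadratic in the momenta
          ∃ (κ : ℝ) (H₂ : BiHam.Phase → ℝ),
            BiHam.PolyInMomenta 2 D H₂ ∧
            BiHam.SolvesBiHam α β κ (BiHam.monoV α β d) H₂ (BiHam.phaseOver D) ∧
            ∃ x ∈ BiHam.phaseOver D, BiHam.IndepAt (BiHam.ham (BiHam.monoV α β d)) H₂ x]) ∧
    -- Each of the four families occurs, with the listed `H₁`, `I₂` and `H₂`.
    (∀ k : Fin 4, BiHam.rowRel k α β d →
      (∀ q₁ q₂ : ℝ, 0 < q₁ → 0 < q₂ → BiHam.monoV α β d q₁ q₂ = BiHam.rowV k d q₁ q₂) ∧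
      BiHam.IsQuadraticIntegral (BiHam.monoV α β d) BiHam.quadrant (BiHam.rowI k d) ∧
      BiHam.phaseOver BiHam.quadrant ⊆ closure {x | x ∈ BiHam.phaseOver BiHam.quadrant ∧
        BiHam.IndepAt (BiHam.ham (BiHam.monoV α β d)) (BiHam.rowI k d) x} ∧
      IsOpen (BiHam.rowDom k d) ∧ (BiHam.rowDom k d).Nonempty ∧
      BiHam.SolvesBiHam α β 1 (BiHam.monoV α β d)
        (fun x => BiHam.rowH k α (BiHam.ham (BiHam.monoV α β d) x) (BiHam.rowI k d x))
        (BiHam.rowDom k d)) ∧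
    -- In the first family the zero function is the only `H₂` that depends on `H₁` and `I₂` alone.
    (α = -β → ∀ (W : Set BiHam.Phase) (H₂ : BiHam.Phase → ℝ),
      IsOpen W → W ⊆ BiHam.phaseOver BiHam.quadrant →
      BiHam.SolvesBiHam α β 1 (BiHam.monoV α β d) H₂ W →
      BiHam.DependsOn H₂ (BiHam.ham (BiHam.monoV α β d)) (BiHam.rowI 0 d) W →
      ∀ x ∈ W, H₂ x = 0) := by
  refine ⟨fun hd he D hD hne hDq => ?_, fun k hk => ?_, fun h W H₂ hW hWq hs hdep x hx =>
    BiHam.solution_eq_zero_of_dependsOn hα h hW hWq hs hdep hx⟩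
  · tfae_have 1 → 2 := fun h => (BiHam.realized_of_inTable hα hβ h hD hne hDq).1
    tfae_have 1 → 4 := fun h => (BiHam.realized_of_inTable hα hβ h hD hne hDq).2
    tfae_have 2 → 3 := fun ⟨I₂, _, _, hI, hind, _⟩ => ⟨I₂, hI, hind⟩
    tfae_have 4 → 3 := fun ⟨_, H₂, hpoly, hs, hind⟩ =>
      ⟨H₂, ⟨hpoly, fun x hx => by
        rw [BiHam.bracket_monoV (hDq hx), BiHam.flow_eq_zero_of_solvesBiHam hα
          (BiHam.isOpen_phaseOver hD) (BiHam.phaseOver_mono hDq) hs hx, neg_zero]⟩, hind⟩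
    tfae_have 3 → 1 := fun ⟨_, hI, _, hx, hind⟩ => BiHam.inTable_of_exponents hα hβ
      (BiHam.exponents_of_quadratic_integral hd he hD hDq hI hx hind)
    tfae_finish
  · have hexpo := BiHam.expo_eq_rowExpo hα hk
    obtain ⟨s, t, hst⟩ := BiHam.exists_mem_rowDom hexpo (q := (1, 1)) ⟨one_pos, one_pos⟩
    exact ⟨fun _ _ h₁ _ => BiHam.monoV_eq_rowV hexpo h₁,
      (BiHam.rowI_isHomogeneousIntegral hα hexpo).isQuadraticIntegral subset_rfl,
      BiHam.phaseOver_subset_closure_indepAt (BiHam.add_one_ne_zero_of_expo hα hexpo),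
      BiHam.isOpen_rowDom hexpo, ⟨_, hst⟩,
      (BiHam.rowH_solves hα hexpo (by rintro rfl; exact hk)).1⟩
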